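/- Let $m>0$ and consider four bodies in the plane $\mathbb{C}$, all of mass $m$, with positions $q_1,\dots,q_4$, mass metric $ds^2=m\sum_j|dq_j|^2$ and $U=\sum_{j<k} m^2/|q_j-q_k|^2$ (minus the $1/r^2$ potential energy). Let $\Delta$ be the set of collision configurations ($q_j=q_k$ for some $j\ne k$). Identify $\mathbb{C}^3$ with the centre-of-mass-zero subspace $\{\sum_j q_j=0\}\subset\mathbb{C}^4$ by the Jacobi coordinates $$q_1=\tfrac{z_1}{2}+\tfrac{z_2}{\sqrt2},\quad q_2=\tfrac{z_1}{2}-\tfrac{z_2}{\sqrt2},\quad q_3=-\tfrac{z_1}{2}+\tfrac{z_3}{\sqrt2},\quad q_4=-\tfrac{z_1}{2}-\tfrac{z_3}{\sqrt2},$$ and restrict $U$, $ds^2$, $\Delta$ to it. The Jacobi–Maupertuis metric on $\mathbb{C}^3\setminus\Delta$ is $U\,ds^2$. Let $\pi:\mathbb{C}^3\setminus\Delta\to Y_4=(\mathbb{C}^3\setminus\Delta)/\mathbb{C}^*=\mathbb{CP}^2\setminus\Delta$ be the quotient by the group of rotations and scalings. There is exactly one smooth Riemannian metric on $Y_4$ for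 which $\pi$ is a Riemannian submersion, i.e. for which $d\pi$ is isometric on the orthogonal complement of $\ker d\pi$; let $\mathcal K$ be its sectional curvature. **Theorem.** There are two-planes $\sigma$ tangent to $Y_4$ with $\mathcal K(\sigma)>0$. More precisely, for every $\phi\in\mathbb{R}$ such that the collinear configuration $$z=(\cos\phi\cos\theta,\ \cos\phi\sin\theta,\ \sin\phi),\qquad \theta=\pi/2,$$ has no collisions, let $p=\pi(z)$, a point of $\mathbb{RP}^2\setminus\Delta=\pi(\mathbb{R}^3\setminus\Delta)$. Then $iT_p\mathbb{RP}^2\subset T_pY_4$ is a real two-plane and $\mathcal K(iT_p\mathbb{RP}^2)>0$. Consequently the metric on $Y_4$ does not have non-positive sectional curvature, so the negative-curvature property of the equal-mass three-body problem (Gaussian curvature negative except at two points, where it is zero) does not persist for four equal masses. -/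

import Mathlib

open scoped Manifold ContDiff

noncomputable section
namespace Riem

variable {E : Type*} [NormedAddCommGroup E] [NormedSpace ℝ E]
  {M : Type*} [TopologicalSpace M] [ChartedSpace E M] [IsManifold 𝓘(ℝ, E) ∞ M]

/-- Smooth Riemannian metrics on a manifold `M` modelled on `E`. -/
abbrev Metric (E : Type*) [NormedAddCommGroup E] [NormedSpace ℝ E]
    (M : Type*) [TopologicalSpace M] [ChartedSpace E M] [IsManifold 𝓘(ℝ, E) ∞ M] :=
  Bundle.ContMDiffRiemannianMetric 𝓘(ℝ, E) ∞ E (fun y : M => TangentSpace 𝓘(ℝ, E) y)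

/-- The metric `g` in the chart around `y₀`: at a point `x` of the chart domain, the pullback of `g`
by the inverse of the chart. -/
def coord (g : Metric E M) (y₀ : M) (x : E) : E →L[ℝ] E →L[ℝ] ℝ :=
  let D : E →L[ℝ] E := mfderiv 𝓘(ℝ, E) 𝓘(ℝ, E) (chartAt E y₀).symm x
  let G : E →L[ℝ] E →L[ℝ] ℝ := g.inner ((chartAt E y₀).symm x)
  G.bilinearComp D D

theorem coord_apply (g : Metric E M) (y₀ : M) (x u v : E) : coord g y₀ x u v =
    g.inner ((chartAt E y₀).symm x) (mfderiv 𝓘(ℝ, E) 𝓘(ℝ, E) (chartAt E y₀).symm x u)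
      (mfderiv 𝓘(ℝ, E) 𝓘(ℝ, E) (chartAt E y₀).symm x v) := rfl

/-- The Christoffel symbols of the first kind of a metric `G` on an open subset of `E`, that is,
the covector `w ↦ (∂_u G(v, w) + ∂_v G(u, w) - ∂_w G(u, v)) / 2`. -/
def koszul (G : E → E →L[ℝ] E →L[ℝ] ℝ) (x u v : E) : E →L[ℝ] ℝ :=
  (1 / 2 : ℝ) • (fderiv ℝ G x u v + fderiv ℝ G x v u - ((fderiv ℝ G x).flip u).flip v)

theorem koszul_apply (G : E → E →L[ℝ] E →L[ℝ] ℝ) (x u v w : E) : koszul G x u v w =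
    (1 / 2 : ℝ) * (fderiv ℝ G x u v w + fderiv ℝ G x v u w - fderiv ℝ G x w u v) := rfl

/-- The Christoffel symbols of the second kind (the Levi-Civita connection of `G`): the index of
`koszul G x u v` is raised with the inverse of the isomorphism `G x : E → E*`. -/
def christoffel (G : E → E →L[ℝ] E →L[ℝ] ℝ) (x u v : E) : E :=
  (G x).inverse (koszul G x u v)

/-- The Riemann curvature operator `R(u, v) w = ∇_u ∇_v w - ∇_v ∇_u w` of the Levi-Civita connection
of `G`, for `u`, `v`, `w` extended as constant (hence commuting) vector fields. -/
def curvature (G : E → E →L[ℝ] E →L[ℝ] ℝ) (x u v w : E) : E :=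
  fderiv ℝ (fun z => christoffel G z v w) x u - fderiv ℝ (fun z => christoffel G z u w) x v
    + christoffel G x u (christoffel G x v w) - christoffel G x v (christoffel G x u w)

/-- The sectional curvature `g(R(u, v) v, u) / (g(u, u) g(v, v) - g(u, v)²)` of `g` at `y` on the plane
spanned by linearly independent `u`, `v`, computed in the chart around `y`. -/
def sectional (g : Metric E M) (y : M) (u v : TangentSpace 𝓘(ℝ, E) y) : ℝ :=
  let x : E := chartAt E y y
  let G := coord g y
  let U : E := mfderiv 𝓘(ℝ, E) 𝓘(ℝ, E) (chartAt E y) y u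
  let V : E := mfderiv 𝓘(ℝ, E) 𝓘(ℝ, E) (chartAt E y) y v
  G x (curvature G x U V V) U / (G x U U * G x V V - G x U V ^ 2)
end Riem

namespace FourBody
/-- Jacobi coordinates on the centre-of-mass-zero subspace. -/
abbrev Jac := EuclideanSpace ℂ (Fin 3)
/-- Positions of four bodies in the plane `ℂ`. -/
abbrev Conf := EuclideanSpace ℂ (Fin 4)
/-- The model space `ℂ²` of the complex surface `Y₄`. -/
abbrev Aff := EuclideanSpace ℂ (Fin 2)

/-- The embedding of Jacobi coordinates: a Hermitian isometry (`inner_jacobi`) of `ℂ³` onto the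
centre-of-mass-zero subspace of `ℂ⁴` (`range_jacobi`). -/
def jacobi : Jac →ₗ[ℂ] Conf :=
  Matrix.toEuclideanLin
    !![1 / 2, 1 / (√2 : ℝ), 0;
       1 / 2, -1 / (√2 : ℝ), 0;
       -1 / 2, 0, 1 / (√2 : ℝ);
       -1 / 2, 0, -1 / (√2 : ℝ)]

theorem jacobi_apply (z : Jac) : jacobi z = !₂[z 0 / 2 + z 1 / (√2 : ℝ), z 0 / 2 - z 1 / (√2 : ℝ),
    -z 0 / 2 + z 2 / (√2 : ℝ), -z 0 / 2 - z 2 / (√2 : ℝ)] := by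
  ext i
  fin_cases i <;> simp [jacobi, Matrix.toLpLin_apply, dotProduct, Fin.sum_univ_three] <;> ring

theorem inner_jacobi (z w : Jac) : inner ℂ (jacobi z) (jacobi w) = inner ℂ z w := by
  have h : ((√2 : ℝ) : ℂ) ^ 2 = 2 := by norm_cast; simp
  have h0 : ((√2 : ℝ) : ℂ) ≠ 0 := by norm_cast; simp
  have h2 : (((√2 : ℝ) : ℂ)⁻¹) ^ 2 = 1 / 2 := by rw [inv_pow, h]; norm_num
  simp only [jacobi_apply, PiLp.inner_apply, Fin.sum_univ_four, Fin.sum_univ_three]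
  simp [Complex.conj_ofReal, div_eq_mul_inv]
  have h3 : (starRingEnd ℂ) (2 : ℂ) = 2 := Complex.conj_ofNat 2
  rw [h3]
  linear_combination (2 * (w 1 * (starRingEnd ℂ) (z 1) + w 2 * (starRingEnd ℂ) (z 2))) * h2

theorem range_jacobi : Set.range jacobi = {q : Conf | ∑ j, q j = 0} := by
  have h : ((√2 : ℝ) : ℂ) ^ 2 = 2 := by norm_cast; simp
  have h0 : ((√2 : ℝ) : ℂ) ≠ 0 := by norm_cast; simp
  ext q
  simp only [Set.mem_range, Set.mem_ofPred_eq, Fin.sum_univ_four]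
  constructor
  · rintro ⟨z, rfl⟩
    simp [jacobi_apply]; ring
  · intro hq
    refine ⟨!₂[q 0 + q 1, (q 0 - q 1) / (√2 : ℝ), (q 2 - q 3) / (√2 : ℝ)], ?_⟩
    rw [jacobi_apply]
    ext i
    fin_cases i <;> simp [div_div, ← pow_two, h] <;> first | ring1 | linear_combination (-1 / 2 : ℂ) * hq

/-- The open set `ℂ³ ∖ Δ` of collision-free configurations. -/
def collisionFree : TopologicalSpace.Opens Jac where
  carrier := {z | ∀ j k : Fin 4, j ≠ k → jacobi z j ≠ jacobi z k}
  is_open' := by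
    have hc : Continuous jacobi := jacobi.continuous_of_finiteDimensional
    simp only [Set.ofPred_forall]
    refine isOpen_iInter_of_finite fun j => isOpen_iInter_of_finite fun k =>
      isOpen_iInter_of_finite fun _ => isOpen_ne_fun (by fun_prop) (by fun_prop)

theorem mem_collisionFree {z : Jac} :
    z ∈ collisionFree ↔ ∀ j k : Fin 4, j ≠ k → jacobi z j ≠ jacobi z k := Iff.rfl

theorem smul_mem (c : ℂˣ) {z : Jac} (hz : z ∈ collisionFree) : (c : ℂ) • z ∈ collisionFree := by
  intro j k hjk h
  rw [map_smul] at h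
  exact hz j k hjk (mul_left_cancel₀ c.ne_zero (by simpa using h))

/-- The group `ℂ*` of rotations and scalings acts on `ℂ³ ∖ Δ`. -/
instance : MulAction ℂˣ collisionFree where
  smul c z := ⟨(c : ℂ) • (z : Jac), smul_mem c z.2⟩
  one_smul z := Subtype.ext (one_smul ℂ (z : Jac))
  mul_smul c d z := Subtype.ext (by
    change ((c * d : ℂˣ) : ℂ) • (z : Jac) = (c : ℂ) • (d : ℂ) • (z : Jac)
    rw [Units.val_mul, mul_smul])

theorem coe_smul (c : ℂˣ) (z : collisionFree) : ((c • z : collisionFree) : Jac) = (c : ℂ) • (z : Jac) :=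
  rfl

/-- Shape space `Y₄ = (ℂ³ ∖ Δ) / ℂ*`, with the quotient topology. -/
def Shape : Type := MulAction.orbitRel.Quotient ℂˣ collisionFree

instance : TopologicalSpace Shape :=
  inferInstanceAs (TopologicalSpace (Quotient (MulAction.orbitRel ℂˣ collisionFree)))

/-- The quotient map `ℂ³ ∖ Δ → Y₄`. -/
def proj (z : collisionFree) : Shape := Quotient.mk (MulAction.orbitRel ℂˣ collisionFree) z

theorem proj_eq_iff {z w : collisionFree} : proj z = proj w ↔ ∃ c : ℂˣ, (c : ℂ) • (w : Jac) = z := by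
  refine Quotient.eq.trans ?_
  rw [MulAction.orbitRel_apply, MulAction.mem_orbit_iff]
  exact exists_congr fun c => Subtype.ext_iff

theorem apply_one_ne_zero (z : collisionFree) : (z : Jac) 1 ≠ 0 := by
  intro h
  refine z.2 0 1 (by decide) ?_
  simp [jacobi_apply, h]

/-- The affine chart `[z₀ : z₁ : z₂] ↦ (z₀ / z₁, z₂ / z₁)` of the complex projective plane. Because
`q₀ - q₁ = √2 z₁`, the line `z₁ = 0` consists of collisions, and so this single chart covers all of
`Y₄ = ℂP² ∖ Δ`. -/
def affine : Shape → Aff :=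
  Quotient.lift (fun z : collisionFree => !₂[(z : Jac) 0 / (z : Jac) 1, (z : Jac) 2 / (z : Jac) 1]) (by
    intro z w h
    obtain ⟨c, hc⟩ := proj_eq_iff.1 (Quotient.sound h)
    rw [← hc]
    simp [mul_div_mul_left _ _ c.ne_zero])

theorem affine_proj (z : collisionFree) :
    affine (proj z) = !₂[(z : Jac) 0 / (z : Jac) 1, (z : Jac) 2 / (z : Jac) 1] := rfl

def lift (x : Aff) : Jac := !₂[x 0, 1, x 1]

theorem lift_affine (z : collisionFree) :
    lift (affine (proj z)) = ((z : Jac) 1)⁻¹ • (z : Jac) := by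
  have := apply_one_ne_zero z
  ext i
  fin_cases i <;> simp [lift, affine_proj] <;> field_simp

theorem affine_proj_lift (x : Aff) (h : lift x ∈ collisionFree) : affine (proj ⟨lift x, h⟩) = x := by
  ext i
  fin_cases i <;> simp [lift, affine_proj]

theorem isOpenEmbedding_affine : Topology.IsOpenEmbedding affine := by
  refine Topology.IsOpenEmbedding.of_continuous_injective_isOpenMap ?_ ?_ ?_
  · refine Continuous.quotient_lift ?_ _
    have h : ∀ i : Fin 3, Continuous fun z : collisionFree => (z : Jac) i := fun i => by fun_prop
    have h1 := (h 0).div (h 1) apply_one_ne_zero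
    have h2 := (h 2).div (h 1) apply_one_ne_zero
    refine (PiLp.continuous_toLp 2 _).comp (continuous_pi fun i => ?_)
    fin_cases i
    · exact h1
    · exact h2
  · intro y y' h
    induction y using Quotient.ind with | _ z
    induction y' using Quotient.ind with | _ w
    have h' : ((z : Jac) 1)⁻¹ • (z : Jac) = ((w : Jac) 1)⁻¹ • (w : Jac) := by
      rw [← lift_affine, ← lift_affine]
      exact congrArg lift h
    refine proj_eq_iff.2 ⟨Units.mk0 ((z : Jac) 1 / (w : Jac) 1)
      (div_ne_zero (apply_one_ne_zero z) (apply_one_ne_zero w)), ?_⟩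
    rw [Units.val_mk0, div_eq_mul_inv, mul_smul, ← h', smul_smul,
      mul_inv_cancel₀ (apply_one_ne_zero z), one_smul]
  · intro O hO
    have hl : Continuous lift := by
      refine (PiLp.continuous_toLp 2 _).comp (continuous_pi fun i => ?_)
      fin_cases i
      · exact (by fun_prop : Continuous fun x : Aff => x 0)
      · exact continuous_const
      · exact (by fun_prop : Continuous fun x : Aff => x 1)
    have hp : Continuous proj := continuous_quotient_mk'
    have key : affine '' O = lift ⁻¹' (Subtype.val '' (proj ⁻¹' O)) := by
      ext x
      constructor
      · rintro ⟨y, hy, rfl⟩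
        induction y using Quotient.ind with | _ z
        change proj z ∈ O at hy
        change lift (affine (proj z)) ∈ Subtype.val '' (proj ⁻¹' O)
        have e : lift (affine (proj z)) =
            (((Units.mk0 _ (apply_one_ne_zero z))⁻¹ : ℂˣ) : ℂ) • (z : Jac) := by
          rw [lift_affine, Units.val_inv_eq_inv_val, Units.val_mk0]
        refine ⟨(Units.mk0 _ (apply_one_ne_zero z))⁻¹ • z, ?_, e.symm⟩
        rw [Set.mem_preimage, (proj_eq_iff (w := z)).2 ⟨_, rfl⟩]
        exact hy
      · rintro ⟨⟨z, hz⟩, hy, h⟩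
        subst h
        exact ⟨_, hy, affine_proj_lift x hz⟩
    rw [key]
    exact ((collisionFree.2.isOpenMap_subtype_val) _ (hO.preimage hp)).preimage hl

theorem sample_mem : (!₂[0, 2, 1] : Jac) ∈ collisionFree := by
  have h0 : ((√2 : ℝ) : ℂ) ≠ 0 := by norm_cast; simp
  intro j k hjk h
  fin_cases j <;> fin_cases k <;> first | exact hjk rfl | skip
  all_goals
    simp [jacobi_apply] at h
    field_simp at h
    norm_num at h

instance : Nonempty Shape := ⟨proj ⟨_, sample_mem⟩⟩

/-- The smooth structure of `Y₄` as an open subset of the complex projective plane, given by the one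
global affine chart. -/
instance : ChartedSpace Aff Shape := isOpenEmbedding_affine.singletonChartedSpace

instance : IsManifold 𝓘(ℝ, Aff) ∞ Shape := isOpenEmbedding_affine.isManifold_singleton

/-- `U = ∑_{j < k} m_j m_k / r_{jk}²` for equal masses `m`. -/
def potential (m : ℝ) (q : Conf) : ℝ :=
  ∑ j, ∑ k ∈ Finset.Ioi j, m * m / ‖q j - q k‖ ^ 2

/-- The mass metric `∑_j m_j ⟨v_j, w_j⟩` on `ℂ⁴ = ℝ⁸` for equal masses `m`. -/
def massInner (m : ℝ) (v w : Conf) : ℝ := ∑ j, m * (inner ℂ (v j) (w j)).re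

/-- The Jacobi–Maupertuis metric `U ds²` on `ℂ³ ∖ Δ`. As `ℂ³ ∖ Δ` is open in `ℂ³`, its tangent spaces
are `ℂ³`. -/
def jm (m : ℝ) (z : collisionFree) (v w : TangentSpace 𝓘(ℝ, Jac) z) : ℝ :=
  potential m (jacobi (z : Jac)) * massInner m (jacobi (v : Jac)) (jacobi (w : Jac))

/-- The differential of the quotient map `ℂ³ ∖ Δ → Y₄`. -/
def dproj (z : collisionFree) : TangentSpace 𝓘(ℝ, Jac) z →L[ℝ] TangentSpace 𝓘(ℝ, Aff) (proj z) :=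
  mfderiv 𝓘(ℝ, Jac) 𝓘(ℝ, Aff) proj z

/-- The horizontal vectors at `z`: those orthogonal to the tangent space `ker dπ` of the orbit. -/
def horizontal (m : ℝ) (z : collisionFree) : Set (TangentSpace 𝓘(ℝ, Jac) z) :=
  {v | ∀ w, dproj z w = 0 → jm m z v w = 0}

/-- `g` makes the quotient map `π : ℂ³ ∖ Δ → Y₄` a Riemannian submersion from the Jacobi–Maupertuis
metric: `π` is a smooth submersion and `dπ` is isometric on horizontal vectors. -/
structure IsRiemannianSubmersion (m : ℝ) (g : Riem.Metric Aff Shape) : Prop where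
  contMDiff : ContMDiff 𝓘(ℝ, Jac) 𝓘(ℝ, Aff) ∞ proj
  surjective (z : collisionFree) : Function.Surjective (dproj z)
  isometry (z : collisionFree) (v w : TangentSpace 𝓘(ℝ, Jac) z) (hv : v ∈ horizontal m z)
    (hw : w ∈ horizontal m z) : g.inner (proj z) (dproj z v) (dproj z w) = jm m z v w

/-- Multiplication by `i` on the tangent spaces of `Y₄`, from the holomorphic chart `affine`. -/
def complexStructure (y : Shape) : TangentSpace 𝓘(ℝ, Aff) y →ₗ[ℝ] TangentSpace 𝓘(ℝ, Aff) y where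
  toFun := fun u : Aff => Complex.I • u
  map_add' := fun u v : Aff => smul_add Complex.I u v
  map_smul' := fun (c : ℝ) (u : Aff) => smul_comm Complex.I c u

/-- The real subspace `ℝ³ ⊆ ℂ³`. -/
def realVectors : Submodule ℝ Jac where
  carrier := {v | ∀ i, (v i).im = 0}
  add_mem' := by intro v w hv hw i; simp [hv i, hw i]
  zero_mem' := by intro i; simp
  smul_mem' := by intro c v hv i; simp [hv i]

/-- For real `z` (a collinear configuration), the tangent space at `[z]` of the image `ℝP² ∖ Δ` of
`ℝ³ ∖ Δ` in `Y₄`. -/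
def tangentRP (z : collisionFree) : Submodule ℝ (TangentSpace 𝓘(ℝ, Aff) (proj z)) :=
  Submodule.map (dproj z).toLinearMap (realVectors : Submodule ℝ Jac)

/-- The plane `i T_{[z]} ℝP²`, for real `z`. -/
def iTangentRP (z : collisionFree) : Submodule ℝ (TangentSpace 𝓘(ℝ, Aff) (proj z)) :=
  (tangentRP z).map (complexStructure (proj z))

/-- The collinear configuration `(cos φ cos θ, cos φ sin θ, sin φ)`, in Jacobi coordinates. -/
def collinear (φ θ : ℝ) : Jac :=
  !₂[((Real.cos φ * Real.cos θ : ℝ) : ℂ), ((Real.cos φ * Real.sin θ : ℝ) : ℂ), ((Real.sin φ : ℝ) : ℂ)]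

/-- `σ` is a tangent two-plane at `y` on which the sectional curvature of `g` is positive. -/
def PositiveOn (g : Riem.Metric Aff Shape) (y : Shape)
    (σ : Submodule ℝ (TangentSpace 𝓘(ℝ, Aff) y)) : Prop :=
  Module.finrank ℝ σ = 2 ∧
    ∀ u ∈ σ, ∀ v ∈ σ, LinearIndependent ℝ ![u, v] → 0 < Riem.sectional g y u v

end FourBody

end

noncomputable section
set_option maxSynthPendingDepth 3

namespace FourBody

/-! ### The tangent bundle of shape space -/

/-! Since U is homogeneous of degree -2, U ds² is invariant under ℂ* and descends to the quotient.
One affine chart x = (z₀/z₁, z₂/z₁) covers shape space. In it the quotient metric is the conformal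
factor mU(1 at z₁) times the Hermitian form Re(⟨u,v⟩ - ⟨u,x⟩⟨x,v⟩/(1+|x|²)), which measures the
component of a lifted vector orthogonal to the orbit (`isRiemannianSubmersion_quotMetric`). Every
tangent vector has a horizontal lift, so no other metric makes π a Riemannian submersion
(`eq_quotMetric`).

For θ = π/2 the configuration is the point (0, t) with t = tan φ, and i T ℝP² is iℝ² in the chart
(`iTangentRP_eq`). The curvature numerator on this plane needs only three second derivatives of the
metric and the Christoffel symbols of the imaginary directions (`Riem.apply_curvature`). The
symmetries x ↦ x̄ and x₀ ↦ -x₀ keep these short. The result is m³ times an explicit function of t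
(`apply_curvature_imag`). Over a common denominator that function has a numerator in t² with
positive coefficients (`curvature_coefficient_pos`). A change of basis multiplies the curvature
numerator and the Gram determinant by the same square, so the sign holds for every basis of the
plane (`Riem.apply_curvature_basis`). -/

theorem coordChange_shape (y y' z : Shape) (v : Aff) :
    (tangentBundleCore 𝓘(ℝ, Aff) Shape).coordChange (achart Aff y) (achart Aff y') z v = v :=
  -- The atlas is a singleton, so the charts at `y`, `y'` and `z` agree definitionally.
  (tangentBundleCore 𝓘(ℝ, Aff) Shape).coordChange_self (achart Aff y) z (mem_achart_source Aff z) v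

theorem symmL_shape (y y' : Shape) (v : Aff) :
    (trivializationAt Aff (TangentSpace 𝓘(ℝ, Aff)) y).symmL ℝ y' v = v :=
  (DFunLike.congr_fun (TangentBundle.symmL_trivializationAt_eq_core (b₀ := y)
    (mem_achart_source Aff y')) v).trans (coordChange_shape _ _ _ _)

/-- The trivializations of the tangent bundle are identities, so smoothness of a section of bilinear
forms reduces to smoothness of its coefficient map. -/
theorem contMDiff_section (h : Shape → Aff →L[ℝ] Aff →L[ℝ] ℝ)
    (hh : ContMDiff 𝓘(ℝ, Aff) 𝓘(ℝ, Aff →L[ℝ] Aff →L[ℝ] ℝ) ∞ h) :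
    ContMDiff 𝓘(ℝ, Aff) (𝓘(ℝ, Aff).prod 𝓘(ℝ, Aff →L[ℝ] Aff →L[ℝ] ℝ)) ∞
      (fun b ↦ Bundle.TotalSpace.mk' (Aff →L[ℝ] Aff →L[ℝ] ℝ)
        (E := fun y : Shape =>
          (TangentSpace 𝓘(ℝ, Aff) y →L[ℝ] TangentSpace 𝓘(ℝ, Aff) y →L[ℝ] ℝ)) b (h b)) := by
  intro y
  rw [contMDiffAt_hom_bundle]
  refine ⟨contMDiffAt_id, ?_⟩
  convert! hh y using 1
  ext z u v
  simp [ContinuousLinearMap.inCoordinates, hom_trivializationAt_apply]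
  exact congrArg₂ (fun a b : Aff => h z a b) (symmL_shape y z u)
    ((Bundle.Trivialization.symmL_apply _ (mem_achart_source Aff z) v).symm.trans (symmL_shape y z v))

theorem proj_surjective : Function.Surjective proj := Quotient.mk_surjective

theorem lift_affine_mem (y : Shape) : lift (affine y) ∈ collisionFree := by
  obtain ⟨z, rfl⟩ := proj_surjective y
  rw [lift_affine]
  exact smul_mem (Units.mk0 _ (apply_one_ne_zero z))⁻¹ z.2

theorem affine_mem_range {x : Aff} (h : lift x ∈ collisionFree) : x ∈ Set.range affine :=
  ⟨_, affine_proj_lift x h⟩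

theorem mfderiv_chart_symm (y : Shape) {x : Aff} (h : lift x ∈ collisionFree) :
    mfderiv 𝓘(ℝ, Aff) 𝓘(ℝ, Aff) (chartAt Aff y).symm x = ContinuousLinearMap.id ℝ Aff := by
  have ht : x ∈ (chartAt Aff y).target := by
    obtain ⟨y', rfl⟩ := affine_mem_range h
    exact (chartAt Aff y).map_source (mem_chart_source Aff y')
  have hm : MDifferentiableAt 𝓘(ℝ, Aff) 𝓘(ℝ, Aff) (chartAt Aff y).symm x :=
    mdifferentiableAt_atlas_symm (chart_mem_atlas Aff y) ht
  rw [hm.mfderiv]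
  have : writtenInExtChartAt 𝓘(ℝ, Aff) 𝓘(ℝ, Aff) x (chartAt Aff y).symm =ᶠ[nhds x] id := by
    filter_upwards [(chartAt Aff y).open_target.mem_nhds ht] with w hw
    exact (chartAt Aff y).right_inv hw
  simp only [modelWithCornersSelf_coe, Set.range_id, fderivWithin_univ]
  exact this.fderiv_eq.trans fderiv_id

theorem mfderiv_chart (y : Shape) :
    mfderiv 𝓘(ℝ, Aff) 𝓘(ℝ, Aff) (chartAt Aff y) y = ContinuousLinearMap.id ℝ Aff := by
  have hm : MDifferentiableAt 𝓘(ℝ, Aff) 𝓘(ℝ, Aff) (chartAt Aff y) y :=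
    mdifferentiableAt_atlas (chart_mem_atlas Aff y) (mem_chart_source Aff y)
  rw [hm.mfderiv]
  have ht : chartAt Aff y y ∈ (chartAt Aff y).target := (chartAt Aff y).map_source (mem_chart_source Aff y)
  have : writtenInExtChartAt 𝓘(ℝ, Aff) 𝓘(ℝ, Aff) y (chartAt Aff y) =ᶠ[nhds (chartAt Aff y y)] id := by
    filter_upwards [(chartAt Aff y).open_target.mem_nhds ht] with w hw
    exact (chartAt Aff y).right_inv hw
  simp only [modelWithCornersSelf_coe, Set.range_id, fderivWithin_univ]
  exact this.fderiv_eq.trans fderiv_id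

/-! ### The differential of the quotient map -/

/-- The quotient map `ℂ³ ∖ Δ → Y₄` in the affine chart, as a map defined on all of `ℂ³`. -/
def affineMap (z : Jac) : Aff := !₂[z 0 / z 1, z 2 / z 1]

/-- The derivative of `affineMap`. -/
def affineDeriv (z v : Jac) : Aff :=
  !₂[(v 0 * z 1 - z 0 * v 1) / z 1 ^ 2, (v 2 * z 1 - z 2 * v 1) / z 1 ^ 2]

theorem contDiffAt_affineMap {z : Jac} (h : z 1 ≠ 0) : ContDiffAt ℝ ∞ affineMap z := by
  have hc : ∀ i : Fin 3, ContDiffAt ℝ ∞ (fun z : Jac => z i) z := fun i => by fun_prop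
  refine (contDiffAt_piLp 2).2 fun i => ?_
  fin_cases i
  · exact (hc 0).mul ((hc 1).inv h)
  · exact (hc 2).mul ((hc 1).inv h)

theorem fderiv_affineMap {z : Jac} (h : z 1 ≠ 0) (v : Jac) :
    fderiv ℝ affineMap z v = affineDeriv z v := by
  have hc : ∀ i : Fin 3, HasFDerivAt (fun z : Jac => z i) (PiLp.proj (𝕜 := ℝ) 2 (fun _ => ℂ) i) z :=
    fun i => (PiLp.proj (𝕜 := ℝ) 2 (fun _ => ℂ) i).hasFDerivAt
  have hd :=
    (hasStrictFDerivAt_piLp 2).1 ((contDiffAt_affineMap h).hasStrictFDerivAt (by simp))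
  have key : ∀ i : Fin 3, ∀ L : Jac →L[ℝ] ℂ, HasFDerivAt (fun z : Jac => z i / z 1) L z →
      L v = (v i * z 1 - z i * v 1) / z 1 ^ 2 := by
    intro i L hL
    -- The quotient rule comes from differentiating (zᵢ/z₁)·z₁ = zᵢ and solving for the unknown
    -- derivative `L v`.
    have h1 : (fun z : Jac => z i / z 1 * z 1) =ᶠ[nhds z] fun z => z i := by
      filter_upwards [(by fun_prop : Continuous fun z : Jac => z 1).continuousAt.eventually_ne h]
        with w hw using div_mul_cancel₀ _ hw
    have h2 := DFunLike.congr_fun (((hL.mul (hc 1)).congr_of_eventuallyEq h1.symm).unique (hc i)) v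
    simp at h2
    field_simp at h2 ⊢
    linear_combination h2
  ext i
  fin_cases i
  · exact key 0 _ (hd 0).hasFDerivAt
  · exact key 2 _ (hd 1).hasFDerivAt

theorem contMDiff_proj : ContMDiff 𝓘(ℝ, Jac) 𝓘(ℝ, Aff) ∞ proj := by
  intro z
  rw [contMDiffAt_iff_target]
  refine ⟨continuous_quotient_mk'.continuousAt, ?_⟩
  exact ((contDiffAt_affineMap (apply_one_ne_zero z)).contMDiffAt).comp z
    (contMDiff_subtype_val (U := collisionFree)).contMDiffAt

theorem dproj_apply (z : collisionFree) (v : Jac) : dproj z v = affineDeriv z v := by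
  have hm : MDifferentiableAt 𝓘(ℝ, Jac) 𝓘(ℝ, Aff) proj z := contMDiff_proj.mdifferentiableAt (by simp)
  have h1 : writtenInExtChartAt 𝓘(ℝ, Jac) 𝓘(ℝ, Aff) z proj =ᶠ[nhds (z : Jac)] affineMap := by
    have ht : (z : Jac) ∈ (chartAt Jac z).target :=
      (chartAt Jac z).map_source (mem_chart_source Jac z)
    filter_upwards [(chartAt Jac z).open_target.mem_nhds ht] with w hw
    have := (chartAt Jac z).right_inv hw
    exact congrArg affineMap this
  rw [dproj, hm.mfderiv]
  simp only [modelWithCornersSelf_coe, Set.range_id, fderivWithin_univ]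
  rw [← fderiv_affineMap (apply_one_ne_zero z) v]
  exact DFunLike.congr_fun h1.fderiv_eq v

/-! ### The quotient metric in the affine chart -/

theorem potential_pos {m : ℝ} (hm : 0 < m) {z : Jac} (hz : z ∈ collisionFree) :
    0 < potential m (jacobi z) := by
  refine Finset.sum_pos' (fun j _ => Finset.sum_nonneg fun k _ => by positivity) ⟨0, Finset.mem_univ _, ?_⟩
  refine Finset.sum_pos (fun k hk => ?_) ⟨1, by decide⟩
  have h : jacobi z 0 - jacobi z k ≠ 0 := sub_ne_zero.2 (hz 0 k (Finset.mem_Ioi.1 hk).ne)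
  have := norm_pos_iff.2 h
  positivity

/-- This scaling cancels that of ds², which is why the metric descends to the quotient. -/
theorem potential_smul (m : ℝ) (c : ℂ) (z : Jac) :
    potential m (jacobi (c • z)) = (‖c‖ ^ 2)⁻¹ * potential m (jacobi z) := by
  simp only [potential, Finset.mul_sum]
  refine Finset.sum_congr rfl fun j _ => Finset.sum_congr rfl fun k _ => ?_
  have : jacobi (c • z) j - jacobi (c • z) k = c * (jacobi z j - jacobi z k) := by
    rw [map_smul]; simp [mul_sub]
  rw [this, norm_mul, mul_pow, div_eq_mul_inv, mul_inv, div_eq_mul_inv]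
  ring

theorem jm_eq (m : ℝ) (z : collisionFree) (v w : Jac) :
    jm m z v w = m * potential m (jacobi z) * (inner ℂ v w).re := by
  have : massInner m (jacobi v) (jacobi w) = m * (inner ℂ v w).re := by
    rw [massInner, ← Finset.mul_sum, ← Complex.re_sum, ← inner_jacobi, PiLp.inner_apply]
  refine (congrArg _ this).trans ?_
  ring

/-- The conformal factor of the quotient metric. -/
def factor (m : ℝ) (x : Aff) : ℝ := m * potential m (jacobi (lift x))

theorem factor_pos {m : ℝ} (hm : 0 < m) {x : Aff} (hx : lift x ∈ collisionFree) : 0 < factor m x :=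
  mul_pos hm (potential_pos hm hx)

/-- The real inner product of `ℂ²`. -/
def realInner : Aff →L[ℝ] Aff →L[ℝ] ℝ := innerSL ℝ

theorem realInner_apply (u v : Aff) : realInner u v = (inner ℂ u v).re := by
  change inner ℝ u v = _
  simp [PiLp.inner_apply]

/-- The real bilinear form `Re (⟨u, v⟩ - ⟨u, x⟩⟨x, v⟩ / (1 + |x|²))` on `ℂ²`. -/
def hermForm (x : Aff) : Aff →L[ℝ] Aff →L[ℝ] ℝ :=
  realInner - (1 + ‖x‖ ^ 2)⁻¹ • ((realInner x).smulRight (realInner x)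
    + (realInner (Complex.I • x)).smulRight (realInner (Complex.I • x)))

/-- The quotient metric on shape space in the affine chart. -/
def quotForm (m : ℝ) (x : Aff) : Aff →L[ℝ] Aff →L[ℝ] ℝ := factor m x • hermForm x

theorem inner_re_comm (u v : Aff) : (inner ℂ u v).re = (inner ℂ v u).re := by
  rw [← inner_conj_symm v u, Complex.conj_re]

theorem inner_im_comm (u v : Aff) : (inner ℂ u v).im = -(inner ℂ v u).im := by
  rw [← inner_conj_symm v u, Complex.conj_im, neg_neg]

theorem hermForm_apply (x u v : Aff) :
    hermForm x u v = (inner ℂ u v - inner ℂ u x * inner ℂ x v / (1 + ‖x‖ ^ 2 : ℝ)).re := by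
  rw [Complex.sub_re, Complex.div_ofReal_re]
  simp only [hermForm, sub_apply, smul_apply, add_apply, ContinuousLinearMap.smulRight_apply,
    realInner_apply, inner_smul_left, smul_eq_mul]
  rw [Complex.mul_re (inner ℂ u x), inner_re_comm u x, inner_im_comm u x]
  simp
  ring

theorem hermForm_symm (x u v : Aff) : hermForm x u v = hermForm x v u := by
  simp only [hermForm_apply, Complex.sub_re, Complex.div_ofReal_re, Complex.mul_re]
  rw [inner_re_comm v u, inner_re_comm u x, inner_im_comm u x, inner_re_comm v x, inner_im_comm v x]
  ring

/-- Cauchy–Schwarz for ⟨x, u⟩. The explicit constant gives both positivity and boundedness of the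
unit balls of the metric. -/
theorem le_hermForm (x u : Aff) : ‖u‖ ^ 2 / (1 + ‖x‖ ^ 2) ≤ hermForm x u u := by
  have h : (0 : ℝ) < 1 + ‖x‖ ^ 2 := by positivity
  have h1 : ‖inner ℂ x u‖ ^ 2 ≤ ‖x‖ ^ 2 * ‖u‖ ^ 2 := by
    rw [← mul_pow]; gcongr; exact norm_inner_le_norm x u
  have h2 : inner ℂ u x * inner ℂ x u = ((‖inner ℂ x u‖ ^ 2 : ℝ) : ℂ) := by
    rw [← inner_conj_symm u x, Complex.conj_mul']; simp
  rw [hermForm_apply, h2, inner_self_eq_norm_sq_to_K, Complex.sub_re, Complex.div_ofReal_re,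
    Complex.ofReal_re, div_le_iff₀ h, sub_mul, div_mul_cancel₀ _ h.ne']
  have h3 : ((↑‖u‖ : ℂ) ^ 2).re = ‖u‖ ^ 2 := by rw [← Complex.ofReal_pow, Complex.ofReal_re]
  change _ ≤ ((↑‖u‖ : ℂ) ^ 2).re * _ - _
  rw [h3]
  linarith

theorem hermForm_pos (x : Aff) {u : Aff} (hu : u ≠ 0) : 0 < hermForm x u u :=
  lt_of_lt_of_le (by have := norm_pos_iff.2 hu; positivity) (le_hermForm x u)

theorem quotForm_apply (m : ℝ) (x u v : Aff) : quotForm m x u v = factor m x * hermForm x u v := rfl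

theorem contDiff_lift : ContDiff ℝ ∞ lift := by
  refine (contDiff_piLp 2).2 fun i => ?_
  fin_cases i
  · exact (by fun_prop : ContDiff ℝ ∞ fun x : Aff => x 0)
  · exact contDiff_const
  · exact (by fun_prop : ContDiff ℝ ∞ fun x : Aff => x 1)

theorem contDiffAt_factor (m : ℝ) {x : Aff} (hx : lift x ∈ collisionFree) :
    ContDiffAt ℝ ∞ (factor m) x := by
  have hj : ∀ j, ContDiff ℝ ∞ fun x : Aff => jacobi (lift x) j := by
    intro j
    have h1 : ContDiff ℝ ∞ (jacobi.toContinuousLinearMap.restrictScalars ℝ) :=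
      ContinuousLinearMap.contDiff _
    have h2 := (contDiff_piLp 2).1 (h1.comp contDiff_lift) j
    exact h2
  refine contDiffAt_const.mul (ContDiffAt.sum fun j _ => ContDiffAt.sum fun k hk => ?_)
  have hjk : jacobi (lift x) j - jacobi (lift x) k ≠ 0 :=
    sub_ne_zero.2 (hx j k (Finset.mem_Ioi.1 hk).ne)
  refine contDiffAt_const.div (((hj j).sub (hj k)).contDiffAt.norm_sq ℝ) ?_
  exact pow_ne_zero 2 (norm_ne_zero_iff.2 hjk)

theorem contDiffAt_smul {E F : Type*} [NormedAddCommGroup E] [NormedSpace ℝ E]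
    [NormedAddCommGroup F] [NormedSpace ℝ F] {f : E → ℝ} {g : E → F} {x : E}
    (hf : ContDiffAt ℝ ∞ f x) (hg : ContDiffAt ℝ ∞ g x) : ContDiffAt ℝ ∞ (fun y => f y • g y) x :=
  hf.smul hg

theorem contDiff_hermForm : ContDiff ℝ ∞ hermForm := by
  have h1 : ContDiff ℝ ∞ fun x : Aff => realInner x := realInner.contDiff
  have h2 : ContDiff ℝ ∞ fun x : Aff => realInner (Complex.I • x) :=
    h1.comp (contDiff_const_smul Complex.I)
  have h3 : ContDiff ℝ ∞ fun x : Aff => (1 + ‖x‖ ^ 2)⁻¹ :=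
    (contDiff_const.add (contDiff_id.norm_sq ℝ)).inv fun x => by positivity
  refine contDiff_const.sub (contDiff_iff_contDiffAt.2 fun x => ?_)
  exact contDiffAt_smul h3.contDiffAt ((h1.smulRight h1).add (h2.smulRight h2)).contDiffAt

theorem contDiffAt_quotForm (m : ℝ) {x : Aff} (hx : lift x ∈ collisionFree) :
    ContDiffAt ℝ ∞ (quotForm m) x :=
  contDiffAt_smul (contDiffAt_factor m hx) contDiff_hermForm.contDiffAt

/-- The quotient metric on shape space. -/
def quotMetric (m : ℝ) (hm : 0 < m) : Riem.Metric Aff Shape where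
  inner y := quotForm m (affine y)
  symm y u v := congrArg (factor m (affine y) * ·) (hermForm_symm (affine y) u v)
  pos y u hu := mul_pos (factor_pos hm (lift_affine_mem y)) (hermForm_pos (affine y) hu)
  isVonNBounded y := by
    have hf := factor_pos hm (lift_affine_mem y)
    set x := affine y
    have h : Bornology.IsVonNBounded ℝ {u : Aff | quotForm m x u u < 1} := by
      rw [NormedSpace.isVonNBounded_iff, isBounded_iff_forall_norm_le]
      -- The `+ 1` avoids a square root: ‖u‖² < c gives ‖u‖ ≤ c + 1, because 2‖u‖ ≤ ‖u‖² + 1.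
      refine ⟨(1 + ‖x‖ ^ 2) / factor m x + 1, fun u hu => ?_⟩
      have h1 : factor m x * (‖u‖ ^ 2 / (1 + ‖x‖ ^ 2)) < 1 :=
        lt_of_le_of_lt (mul_le_mul_of_nonneg_left (le_hermForm x u) hf.le) hu
      have h2 : ‖u‖ ^ 2 < (1 + ‖x‖ ^ 2) / factor m x := by
        rw [lt_div_iff₀ hf]
        rw [← mul_div_assoc, div_lt_one (by positivity)] at h1
        linarith
      nlinarith [sq_nonneg (‖u‖ - 1)]
    exact h
  contMDiff := by
    refine contMDiff_section (fun y => quotForm m (affine y)) fun y => ?_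
    exact (contDiffAt_quotForm m (lift_affine_mem y)).contMDiffAt.comp y
      (contMDiffAt_extChartAt (I := 𝓘(ℝ, Aff)) (x := y))

/-! ### The Riemannian submersion -/

/-- The linear part of `lift`. -/
def liftLinear (u : Aff) : Jac := !₂[u 0, 0, u 1]

theorem inner_lift_liftLinear (x u : Aff) : inner ℂ (lift x) (liftLinear u) = inner ℂ x u := by
  simp [PiLp.inner_apply, Fin.sum_univ_three, lift, liftLinear]

theorem inner_liftLinear (u v : Aff) : inner ℂ (liftLinear u) (liftLinear v) = inner ℂ u v := by
  simp [PiLp.inner_apply, Fin.sum_univ_three, liftLinear]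

theorem norm_lift_sq (x : Aff) : ‖lift x‖ ^ 2 = 1 + ‖x‖ ^ 2 := by
  simp [EuclideanSpace.norm_sq_eq, Fin.sum_univ_three, lift]
  ring

theorem affineDeriv_eq_zero_iff {z : Jac} (h : z 1 ≠ 0) (v : Jac) :
    affineDeriv z v = 0 ↔ ∃ c : ℂ, v = c • z := by
  constructor
  · intro hv
    have h0 : (v 0 * z 1 - z 0 * v 1) / z 1 ^ 2 = 0 := congrArg (fun w : Aff => w 0) hv
    have h2 : (v 2 * z 1 - z 2 * v 1) / z 1 ^ 2 = 0 := congrArg (fun w : Aff => w 1) hv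
    rw [div_eq_zero_iff, or_iff_left (pow_ne_zero 2 h)] at h0 h2
    refine ⟨v 1 / z 1, ?_⟩
    ext i
    fin_cases i
    · simp; field_simp; linear_combination h0
    · simp; field_simp
    · simp; field_simp; linear_combination h2
  · rintro ⟨c, rfl⟩
    ext i
    fin_cases i <;> simp [affineDeriv] <;> exact Or.inl (by ring)

/-- Up to a vertical vector, lifting dπ(v) back to the slice z₁ = 1 only rescales `v` by 1/z₁. -/
theorem liftLinear_affineDeriv {z : Jac} (h : z 1 ≠ 0) (v : Jac) :
    liftLinear (affineDeriv z v) = (z 1)⁻¹ • v - (v 1 / z 1 ^ 2) • z := by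
  ext i
  fin_cases i <;> simp [liftLinear, affineDeriv] <;> field_simp <;> ring

/-- The kernel of dπ is the complex line ℂz. Real orthogonality to z and to iz kills the real and
imaginary parts of the Hermitian product. -/
theorem mem_horizontal {m : ℝ} (hm : 0 < m) {z : collisionFree} {v : Jac} :
    v ∈ horizontal m z ↔ inner ℂ (z : Jac) v = 0 := by
  have hp := mul_pos hm (potential_pos hm z.2)
  constructor
  · intro h
    have key : ∀ c : ℂ, (inner ℂ v (c • (z : Jac))).re = 0 := fun c => by
      have h1 := h (c • (z : Jac))
        ((dproj_apply z _).trans ((affineDeriv_eq_zero_iff (apply_one_ne_zero z) _).2 ⟨c, rfl⟩))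
      have h2 := (jm_eq m z v (c • (z : Jac))).symm.trans h1
      exact (mul_eq_zero.1 h2).resolve_left hp.ne'
    have h1 := key 1
    have h2 := key Complex.I
    rw [← inner_conj_symm, map_eq_zero]
    rw [one_smul] at h1
    rw [inner_smul_right] at h2
    refine Complex.ext h1 ?_
    simpa using h2
  · intro h w hw
    obtain ⟨c, rfl⟩ := (affineDeriv_eq_zero_iff (apply_one_ne_zero z) w).1
      ((dproj_apply z w).symm.trans hw)
    refine (jm_eq m z v _).trans ?_
    rw [inner_smul_right, ← inner_conj_symm, h]
    simp

/-- `hermForm x` pairs the components of lifted vectors orthogonal to `lift x`. By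
`liftLinear_affineDeriv` these components are v/z₁ and w/z₁ when v and w are horizontal. -/
theorem hermForm_affineDeriv {z : Jac} (h : z 1 ≠ 0) {x : Aff} (hx : lift x = (z 1)⁻¹ • z) {v w : Jac}
    (hv : inner ℂ z v = 0) (hw : inner ℂ z w = 0) :
    hermForm x (affineDeriv z v) (affineDeriv z w) = (‖z 1‖ ^ 2)⁻¹ * (inner ℂ v w).re := by
  have hv' : inner ℂ v z = 0 := by rw [← inner_conj_symm, hv, map_zero]
  have hz : (inner ℂ z z : ℂ) ≠ 0 := inner_self_ne_zero.2 (by rintro rfl; simp at h)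
  have hn : ((1 + ‖x‖ ^ 2 : ℝ) : ℂ) = inner ℂ (lift x) (lift x) := by
    rw [← norm_lift_sq, inner_self_eq_norm_sq_to_K]; simp
  have hc : (starRingEnd ℂ) (z 1) ≠ 0 := by simpa using h
  rw [hermForm_apply, hn, ← inner_conj_symm _ x, ← inner_liftLinear, ← inner_lift_liftLinear,
    ← inner_lift_liftLinear, inner_conj_symm, liftLinear_affineDeriv h,
    liftLinear_affineDeriv h, hx]
  simp only [inner_sub_left, inner_sub_right, inner_smul_left, inner_smul_right, hw, hv', map_inv₀,
    map_div₀, map_pow]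
  rw [← Complex.re_ofReal_mul]
  congr 1
  have : (((‖z 1‖ ^ 2)⁻¹ : ℝ) : ℂ) = (starRingEnd ℂ (z 1))⁻¹ * (z 1)⁻¹ := by
    rw [← mul_inv, Complex.conj_mul']; simp
  rw [this]
  field_simp
  ring

/-- Take any lift and subtract its projection to ℂz, which dπ does not see. -/
theorem exists_horizontal_lift {m : ℝ} (hm : 0 < m) (z : collisionFree) (u : Aff) :
    ∃ v : Jac, v ∈ horizontal m z ∧ dproj z v = u := by
  have h := apply_one_ne_zero z
  have hz : (inner ℂ (z : Jac) (z : Jac) : ℂ) ≠ 0 :=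
    inner_self_ne_zero.2 (by intro h'; rw [h'] at h; simp at h)
  set e := (z : Jac) 1 • liftLinear u
  set c : ℂ := inner ℂ (z : Jac) e / inner ℂ (z : Jac) (z : Jac)
  refine ⟨e - c • (z : Jac), (mem_horizontal hm).2 ?_, (dproj_apply z _).trans ?_⟩
  · rw [inner_sub_right, inner_smul_right (z : Jac) (z : Jac), div_mul_cancel₀ _ hz, sub_self]
  · change (affineDeriv z (e - c • (z : Jac)) : Aff) = u
    ext i
    fin_cases i <;> simp [affineDeriv, e, liftLinear] <;> field_simp <;> ring

theorem isRiemannianSubmersion_quotMetric (m : ℝ) (hm : 0 < m) :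
    IsRiemannianSubmersion m (quotMetric m hm) where
  contMDiff := contMDiff_proj
  surjective z u := (exists_horizontal_lift hm z u).imp fun _ h => h.2
  isometry z v w hv hw := by
    have h := apply_one_ne_zero z
    have key (v w : Jac) (hv : v ∈ horizontal m z) (hw : w ∈ horizontal m z) :
        quotForm m (affine (proj z)) (affineDeriv z v) (affineDeriv z w)
          = m * potential m (jacobi (z : Jac)) * (inner ℂ v w).re := by
      -- Passing from z to z/z₁ multiplies the potential by |z₁|², which cancels the |z₁|⁻² of the
      -- Hermitian form.
      rw [quotForm_apply, hermForm_affineDeriv h (lift_affine z) ((mem_horizontal hm).1 hv)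
        ((mem_horizontal hm).1 hw), factor, lift_affine, potential_smul]
      have := norm_pos_iff.2 h
      rw [norm_inv]
      field_simp
    refine (congrArg₂ (fun a b : Aff => quotForm m (affine (proj z)) a b) (dproj_apply z v)
      (dproj_apply z w)).trans ?_
    exact (key v w hv hw).trans (jm_eq m z v w).symm

/-- Images of horizontal vectors exhaust each tangent space, and the submersion condition prescribes
the inner product on them. -/
theorem eq_quotMetric {m : ℝ} (hm : 0 < m) {g : Riem.Metric Aff Shape}
    (hg : IsRiemannianSubmersion m g) : g = quotMetric m hm := by
  have hi : g.inner = (quotMetric m hm).inner := by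
    funext y
    obtain ⟨z, rfl⟩ := proj_surjective y
    refine ContinuousLinearMap.ext fun u => ContinuousLinearMap.ext fun v => ?_
    obtain ⟨u', hu, rfl⟩ := exists_horizontal_lift hm z u
    obtain ⟨v', hv, rfl⟩ := exists_horizontal_lift hm z v
    exact (hg.isometry z u' v' hu hv).trans
      ((isRiemannianSubmersion_quotMetric m hm).isometry z u' v' hu hv).symm
  cases g
  cases hi
  rfl

/-! ### The metric and its curvature in the chart -/

theorem isOpen_lift_mem : IsOpen {x : Aff | lift x ∈ collisionFree} :=
  collisionFree.2.preimage contDiff_lift.continuous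

theorem coord_quotMetric (m : ℝ) (hm : 0 < m) (y : Shape) {x : Aff} (hx : lift x ∈ collisionFree) :
    Riem.coord (quotMetric m hm) y x = quotForm m x := by
  ext u v
  have h : affine ((chartAt Aff y).symm x) = x := by
    obtain ⟨y', rfl⟩ := affine_mem_range hx
    exact (chartAt Aff y).right_inv ((chartAt Aff y).map_source (mem_chart_source Aff y'))
  have hd := fun w => DFunLike.congr_fun (mfderiv_chart_symm y hx) w
  rw [Riem.coord_apply]
  refine (congrArg₂ (fun a b : Aff => (quotMetric m hm).inner ((chartAt Aff y).symm x) a b)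
    (hd u) (hd v)).trans ?_
  change quotForm m (affine ((chartAt Aff y).symm x)) u v = _
  rw [h]

end FourBody

/-! ### Dependence of the curvature on the germ of the metric -/

namespace Riem
variable {E : Type*} [NormedAddCommGroup E] [NormedSpace ℝ E]

open Filter Topology

theorem koszul_congr {G G' : E → E →L[ℝ] E →L[ℝ] ℝ} {x : E} (h : G =ᶠ[𝓝 x] G') (u v : E) :
    koszul G x u v = koszul G' x u v := by
  rw [koszul, koszul, h.fderiv_eq]

theorem christoffel_congr {G G' : E → E →L[ℝ] E →L[ℝ] ℝ} {x : E} (h : G =ᶠ[𝓝 x] G') (u v : E) :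
    christoffel G x u v = christoffel G' x u v := by
  rw [christoffel, christoffel, koszul_congr h, h.eq_of_nhds]

theorem curvature_congr {G G' : E → E →L[ℝ] E →L[ℝ] ℝ} {x : E} (h : G =ᶠ[𝓝 x] G') (u v w : E) :
    curvature G x u v w = curvature G' x u v w := by
  have hc : ∀ a b, (fun z => christoffel G z a b) =ᶠ[𝓝 x] fun z => christoffel G' z a b :=
    fun a b => h.eventuallyEq_nhds.mono fun z hz => christoffel_congr hz a b
  simp only [curvature, (hc _ _).fderiv_eq, christoffel_congr h]

end Riem

namespace FourBody
theorem sectional_quotMetric (m : ℝ) (hm : 0 < m) (y : Shape) (u v : Aff) :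
    Riem.sectional (quotMetric m hm) y u v =
      quotForm m (affine y) (Riem.curvature (quotForm m) (affine y) u v v) u /
      (quotForm m (affine y) u u * quotForm m (affine y) v v - quotForm m (affine y) u v ^ 2) := by
  have hy := lift_affine_mem y
  have hd := fun w => DFunLike.congr_fun (mfderiv_chart y) w
  have he : Riem.coord (quotMetric m hm) y =ᶠ[nhds (affine y)] quotForm m := by
    filter_upwards [isOpen_lift_mem.mem_nhds hy] with x hx using coord_quotMetric m hm y hx
  simp only [← Riem.curvature_congr he]
  rw [← he.eq_of_nhds]
  have e1 : mfderiv 𝓘(ℝ, Aff) 𝓘(ℝ, Aff) (chartAt Aff y) y u = u := hd u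
  have e2 : mfderiv 𝓘(ℝ, Aff) 𝓘(ℝ, Aff) (chartAt Aff y) y v = v := hd v
  unfold Riem.sectional
  simp only [e1, e2]
  rfl
end FourBody

/-! ### The curvature numerator in terms of derivatives of the metric -/

namespace Riem
open Filter Topology
variable {E : Type*} [NormedAddCommGroup E] [NormedSpace ℝ E]
  {G : E → E →L[ℝ] E →L[ℝ] ℝ} {x : E}

theorem isInvertible_of_pos [FiniteDimensional ℝ E] {B : E →L[ℝ] E →L[ℝ] ℝ}
    (h : ∀ u, u ≠ 0 → 0 < B u u) : B.IsInvertible := by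
  have hi : Function.Injective B := by
    refine (injective_iff_map_eq_zero B).2 fun u hu => ?_
    by_contra hne
    have := h u hne
    rw [hu] at this
    exact lt_irrefl _ this
  have hr : Module.finrank ℝ E = Module.finrank ℝ (E →L[ℝ] ℝ) := by
    rw [← (LinearMap.toContinuousLinearMap (𝕜 := ℝ) (E := E) (F' := ℝ)).finrank_eq]
    exact Subspace.dual_finrank_eq.symm
  let e : E ≃L[ℝ] (E →L[ℝ] ℝ) :=
    (LinearEquiv.ofInjectiveOfFinrankEq B.toLinearMap hi hr).toContinuousLinearEquiv
  exact ⟨e, by ext1 u; rfl⟩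

theorem christoffel_spec (h : (G x).IsInvertible) (u v : E) :
    G x (christoffel G x u v) = koszul G x u v := by
  obtain ⟨e, he⟩ := h
  rw [christoffel, ← he, ContinuousLinearMap.inverse_equiv]
  exact e.apply_symm_apply _

theorem christoffel_eq (h : (G x).IsInvertible) {u v w : E} (hw : G x w = koszul G x u v) :
    christoffel G x u v = w := by
  obtain ⟨e, he⟩ := h
  rw [christoffel, ← hw, ← he, ContinuousLinearMap.inverse_equiv]
  exact e.symm_apply_apply _

theorem fderiv_symm (hG : DifferentiableAt ℝ G x) (hs : ∀ᶠ z in 𝓝 x, ∀ u v, G z u v = G z v u)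
    (u v w : E) : fderiv ℝ G x u v w = fderiv ℝ G x u w v := by
  have h1 : ∀ v w, fderiv ℝ (fun z => G z v w) x u = fderiv ℝ G x u v w := by
    intro v w
    rw [((hG.hasFDerivAt.clm_apply (hasFDerivAt_const v x)).clm_apply (hasFDerivAt_const w x)).fderiv]
    simp
  rw [← h1, ← h1, EventuallyEq.fderiv_eq]
  filter_upwards [hs] with z hz using hz v w

theorem differentiableAt_fderiv (hG : ContDiffAt ℝ ∞ G x) : DifferentiableAt ℝ (fderiv ℝ G) x :=
  (hG.fderiv_right (m := 1) (by norm_cast)).differentiableAt (by simp)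

theorem fderiv_fderiv_apply (hG : ContDiffAt ℝ ∞ G x) (u a b c : E) :
    fderiv ℝ (fun z => fderiv ℝ G z a b c) x u = fderiv ℝ (fderiv ℝ G) x u a b c := by
  have h := (differentiableAt_fderiv hG).hasFDerivAt
  rw [(((h.clm_apply (hasFDerivAt_const a x)).clm_apply (hasFDerivAt_const b x)).clm_apply
    (hasFDerivAt_const c x)).fderiv]
  simp

theorem fderiv_fderiv_symm (hG : ContDiffAt ℝ ∞ G x)
    (hs : ∀ᶠ z in 𝓝 x, ∀ u v, G z u v = G z v u) (u v a b : E) :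
    fderiv ℝ (fderiv ℝ G) x u v a b = fderiv ℝ (fderiv ℝ G) x u v b a := by
  rw [← fderiv_fderiv_apply hG, ← fderiv_fderiv_apply hG, EventuallyEq.fderiv_eq]
  filter_upwards [hs.eventually_nhds, (hG.of_le (m := 1) (by simp)).eventually (by simp)] with z hz hz'
  exact fderiv_symm (hz'.differentiableAt (by simp)) hz v a b

theorem fderiv_fderiv_comm (hG : ContDiffAt ℝ ∞ G x) (u v : E) :
    fderiv ℝ (fderiv ℝ G) x u v = fderiv ℝ (fderiv ℝ G) x v u :=
  hG.isSymmSndFDerivAt (by simp; norm_cast) u v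

theorem contDiffAt_koszul (hG : ContDiffAt ℝ ∞ G x) (u v : E) :
    ContDiffAt ℝ 1 (fun z => koszul G z u v) x := by
  have h : ContDiffAt ℝ 1 (fderiv ℝ G) x := hG.fderiv_right (by norm_cast)
  have hf : ContDiffAt ℝ 1 (fun z => ((fderiv ℝ G z).flip u).flip v) x := by
    have h1 : ContDiffAt ℝ 1 (fun z => (fderiv ℝ G z).flip) x :=
      (ContinuousLinearMap.flipₗᵢ ℝ E E (E →L[ℝ] ℝ)).toContinuousLinearEquiv.contDiff.contDiffAt.comp x h
    have h2 := h1.clm_apply (contDiffAt_const (c := u))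
    have h3 : ContDiffAt ℝ 1 (fun z => ((fderiv ℝ G z).flip u).flip) x :=
      (ContinuousLinearMap.flipₗᵢ ℝ E E ℝ).toContinuousLinearEquiv.contDiff.contDiffAt.comp x h2
    exact h3.clm_apply (contDiffAt_const (c := v))
  exact ((((h.clm_apply contDiffAt_const).clm_apply contDiffAt_const).add
    ((h.clm_apply contDiffAt_const).clm_apply contDiffAt_const)).sub hf).const_smul (1 / 2 : ℝ)

theorem differentiableAt_christoffel [CompleteSpace E] (hG : ContDiffAt ℝ ∞ G x)
    (hi : (G x).IsInvertible) (u v : E) :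
    DifferentiableAt ℝ (fun z => christoffel G z u v) x := by
  obtain ⟨e, he⟩ := hi
  have h1 : ContDiffAt ℝ 1 ContinuousLinearMap.inverse (G x) := he ▸ contDiffAt_map_inverse e
  have h2 := h1.comp x (hG.of_le (m := 1) (by simp))
  exact (h2.clm_apply (contDiffAt_koszul hG u v)).differentiableAt (by simp)

theorem fderiv_koszul_apply (hG : ContDiffAt ℝ ∞ G x) (u v w s : E) :
    fderiv ℝ (fun z => koszul G z v w s) x u = (1 / 2 : ℝ) *
      (fderiv ℝ (fderiv ℝ G) x u v w s + fderiv ℝ (fderiv ℝ G) x u w v s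
        - fderiv ℝ (fderiv ℝ G) x u s v w) := by
  have hd : ∀ a b c, DifferentiableAt ℝ (fun z => fderiv ℝ G z a b c) x := fun a b c =>
    (((differentiableAt_fderiv hG).clm_apply (differentiableAt_const a)).clm_apply
      (differentiableAt_const b)).clm_apply (differentiableAt_const c)
  simp only [koszul_apply, ← fderiv_fderiv_apply hG]
  have h : HasFDerivAt (fun z => (1 / 2 : ℝ) *
      (fderiv ℝ G z v w s + fderiv ℝ G z w v s - fderiv ℝ G z s v w)) _ x :=
    (((hd v w s).hasFDerivAt.add (hd w v s).hasFDerivAt).sub (hd s v w).hasFDerivAt).const_mul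
      (1 / 2 : ℝ)
  rw [h.fderiv]
  simp

/-- Differentiating the identity `christoffel_spec` avoids computing the derivative of the inverse
metric. -/
theorem apply_fderiv_christoffel [CompleteSpace E] (hG : ContDiffAt ℝ ∞ G x)
    (hi : ∀ᶠ z in 𝓝 x, (G z).IsInvertible) (u v w s : E) :
    G x (fderiv ℝ (fun z => christoffel G z v w) x u) s =
      fderiv ℝ (fun z => koszul G z v w s) x u - fderiv ℝ G x u (christoffel G x v w) s := by
  have hd := (differentiableAt_christoffel hG hi.self_of_nhds v w).hasFDerivAt
  have hg := (hG.differentiableAt (by simp)).hasFDerivAt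
  have h1 : (fun z => G z (christoffel G z v w) s) =ᶠ[𝓝 x] fun z => koszul G z v w s := by
    filter_upwards [hi] with z hz using DFunLike.congr_fun (christoffel_spec hz v w) s
  rw [← h1.fderiv_eq, ((hg.clm_apply hd).clm_apply (hasFDerivAt_const s x)).fderiv]
  simp

/-- With the index lowered, the corrections -∂ᵤG(Γᵥᵥ, u) and ∂ᵥG(Γᵤᵥ, u) combine with the ΓΓ terms
of the curvature. Only two products of Christoffel symbols survive. -/
theorem apply_curvature [CompleteSpace E] (hG : ContDiffAt ℝ ∞ G x)
    (hs : ∀ᶠ z in 𝓝 x, ∀ u v, G z u v = G z v u)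
    (hi : ∀ᶠ z in 𝓝 x, (G z).IsInvertible) (u v : E) :
    G x (curvature G x u v v) u =
      fderiv ℝ (fderiv ℝ G) x u v u v - (1 / 2 : ℝ) * fderiv ℝ (fderiv ℝ G) x u u v v
        - (1 / 2 : ℝ) * fderiv ℝ (fderiv ℝ G) x v v u u
        - koszul G x u u (christoffel G x v v) + koszul G x u v (christoffel G x u v) := by
  have hs1 := fderiv_symm (hG.differentiableAt (by simp)) hs
  have hs2 := fderiv_fderiv_symm hG hs
  simp only [curvature, map_add, map_sub, add_apply, sub_apply,
    apply_fderiv_christoffel hG hi, christoffel_spec hi.self_of_nhds, fderiv_koszul_apply hG]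
  simp only [koszul_apply]
  rw [hs2 u v v u, hs2 v u v u, hs1 u (christoffel G x v v) u, hs1 v (christoffel G x u v) u,
    hs1 (christoffel G x u v) v u]
  ring

/-- The numerator of the sectional curvature changes by the square of the determinant under a change
of basis. -/
theorem apply_curvature_basis [CompleteSpace E] (hG : ContDiffAt ℝ ∞ G x)
    (hs : ∀ᶠ z in 𝓝 x, ∀ u v, G z u v = G z v u)
    (hi : ∀ᶠ z in 𝓝 x, (G z).IsInvertible) (u v : E) (a b c d : ℝ) :
    G x (curvature G x (a • u + b • v) (c • u + d • v) (c • u + d • v)) (a • u + b • v) =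
      (a * d - b * c) ^ 2 * G x (curvature G x u v v) u := by
  have hs1 := fderiv_symm (hG.differentiableAt (by simp)) hs
  have hs2 := fderiv_fderiv_symm hG hs
  have hs0 := hs.self_of_nhds
  have hi0 := hi.self_of_nhds
  have hk : ∀ p q, koszul G x p q = koszul G x q p := by
    intro p q
    ext w
    simp only [koszul_apply]
    rw [hs1 w p q]; ring
  have hc : ∀ p q, christoffel G x p q = christoffel G x q p := fun p q => by
    rw [christoffel, hk, christoffel]
  have hb : ∀ (a b c d : ℝ), koszul G x (a • u + b • v) (c • u + d • v) =
      (a * c) • koszul G x u u + (a * d + b * c) • koszul G x u v + (b * d) • koszul G x v v := by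
    intro a b c d
    rw [add_smul, show (b * c) • koszul G x u v = (b * c) • koszul G x v u by rw [hk]]
    ext w
    simp only [koszul_apply, map_add, map_smul, add_apply, smul_apply, smul_eq_mul]
    ring
  have hcb : ∀ (a b c d : ℝ), christoffel G x (a • u + b • v) (c • u + d • v) =
      (a * c) • christoffel G x u u + (a * d + b * c) • christoffel G x u v
        + (b * d) • christoffel G x v v := by
    intro a b c d
    simp only [christoffel, hb, map_add, map_smul]
  -- Both sides are the inner product of the vectors Γ(p, q) and Γ(r, t).
  have hkc : ∀ p q r t, koszul G x p q (christoffel G x r t) = koszul G x r t (christoffel G x p q) := by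
    intro p q r t
    rw [← christoffel_spec hi0, ← christoffel_spec hi0, hs0]
  simp only [apply_curvature hG hs hi, hb, hcb, map_add, map_smul, add_apply, smul_apply, smul_eq_mul]
  have hs3 := fderiv_fderiv_comm hG v u
  simp only [hs3, hs2 _ _ v u, hkc v v u u, hkc u v u u, hkc v v u v]
  ring

/-! ### Derivatives of the metric computed along lines -/

theorem hasDerivAt_line (hG : DifferentiableAt ℝ G x) (u a b : E) :
    HasDerivAt (fun q : ℝ => G (x + q • u) a b) (fderiv ℝ G x u a b) 0 := by
  have hl : HasDerivAt (fun q : ℝ => x + q • u) u 0 := by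
    simpa using ((hasDerivAt_id (0 : ℝ)).smul_const u).const_add x
  have h0 : HasFDerivAt G (fderiv ℝ G x) (x + (0 : ℝ) • u) := by simpa using hG.hasFDerivAt
  have h1 := h0.comp_hasDerivAt 0 hl
  have h2 := (h1.clm_apply (hasDerivAt_const 0 a)).clm_apply (hasDerivAt_const 0 b)
  simpa using h2

theorem fderiv_eq_of_line (hG : DifferentiableAt ℝ G x) {u a b : E} {c : ℝ}
    (h : HasDerivAt (fun q : ℝ => G (x + q • u) a b) c 0) : fderiv ℝ G x u a b = c :=
  (hasDerivAt_line hG u a b).unique h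

theorem tendsto_line (x u : E) : Tendsto (fun p : ℝ => x + p • u) (𝓝 0) (𝓝 x) := by
  have : Continuous fun p : ℝ => x + p • u := by fun_prop
  simpa using this.tendsto 0

/-- A second derivative as an iterated directional derivative. -/
theorem fderiv_fderiv_eq_of_line (hG : ContDiffAt ℝ ∞ G x) {u v a b : E} {ψ : ℝ → ℝ} {c : ℝ}
    (h : ∀ᶠ p in 𝓝 (0 : ℝ), HasDerivAt (fun q : ℝ => G (x + p • u + q • v) a b) (ψ p) 0)
    (hψ : HasDerivAt ψ c 0) : fderiv ℝ (fderiv ℝ G) x u v a b = c := by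
  have hd : ∀ᶠ z in 𝓝 x, DifferentiableAt ℝ G z :=
    ((hG.of_le (m := 1) (by simp)).eventually (by simp)).mono fun z hz => hz.differentiableAt (by simp)
  have h1 : ψ =ᶠ[𝓝 0] fun p => fderiv ℝ G (x + p • u) v a b := by
    filter_upwards [h, (tendsto_line x u).eventually hd] with p hp hp'
    exact (fderiv_eq_of_line hp' hp).symm
  have hφ : DifferentiableAt ℝ (fun z => fderiv ℝ G z v a b) x :=
    (((differentiableAt_fderiv hG).clm_apply (differentiableAt_const v)).clm_apply
      (differentiableAt_const a)).clm_apply (differentiableAt_const b)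
  have hl : HasDerivAt (fun q : ℝ => x + q • u) u 0 := by
    simpa using ((hasDerivAt_id (0 : ℝ)).smul_const u).const_add x
  rw [← fderiv_fderiv_apply hG]
  exact (hφ.hasFDerivAt.comp_hasDerivAt_of_eq 0 hl (by simp)).unique
    (hψ.congr_of_eventuallyEq h1.symm)

/-- The difference quotient of q·k(q) at 0 is k(q) itself, so `k` need not be differentiable. -/
theorem hasDerivAt_id_mul {k : ℝ → ℝ} (hk : ContinuousAt k 0) :
    HasDerivAt (fun q => q * k q) (k 0) 0 := by
  rw [hasDerivAt_iff_tendsto_slope]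
  refine (hk.tendsto.mono_left nhdsWithin_le_nhds).congr' ?_
  filter_upwards [self_mem_nhdsWithin] with q hq
  have hq' : q ≠ 0 := hq
  simp [slope, hq']

/-- The second derivative along a line on which the function is even. -/
theorem fderiv_fderiv_eq_of_even (hG : ContDiffAt ℝ ∞ G x) {u a b : E} {Φ : ℝ → ℝ} {c : ℝ}
    (h : ∀ᶠ p in 𝓝 (0 : ℝ), G (x + p • u) a b = Φ (p ^ 2)) (hΦ : ContDiffAt ℝ 1 Φ 0)
    (hc : HasDerivAt Φ c 0) : fderiv ℝ (fderiv ℝ G) x u u a b = 2 * c := by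
  have hsq : Tendsto (fun p : ℝ => p ^ 2) (𝓝 0) (𝓝 0) := by
    simpa using (continuous_pow 2 : Continuous fun p : ℝ => p ^ 2).tendsto 0
  have hd : ∀ᶠ s in 𝓝 (0 : ℝ), DifferentiableAt ℝ Φ s :=
    (hΦ.eventually (by simp)).mono fun z hz => hz.differentiableAt (by simp)
  -- The explicit factor p in the derivative of Φ(p²) lets `hasDerivAt_id_mul` finish with Φ only
  -- C¹.
  refine fderiv_fderiv_eq_of_line hG (ψ := fun p => p * (2 * deriv Φ (p ^ 2))) ?_ ?_
  · filter_upwards [h.eventually_nhds, hsq.eventually hd] with p hp hp'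
    have h1 : HasDerivAt (fun q : ℝ => Φ ((p + q) ^ 2)) (p * (2 * deriv Φ (p ^ 2))) 0 := by
      have h2 : HasDerivAt (fun q : ℝ => (p + q) ^ 2) (2 * p) 0 := by
        simpa using ((hasDerivAt_id (0 : ℝ)).const_add p).fun_pow 2
      have h4 := hp'.hasDerivAt.comp_of_eq 0 h2 (by simp)
      rw [show p * (2 * deriv Φ (p ^ 2)) = deriv Φ (p ^ 2) * (2 * p) by ring]
      exact h4
    refine h1.congr_of_eventuallyEq ?_
    have ht : Tendsto (fun q : ℝ => p + q) (𝓝 0) (𝓝 p) := by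
      simpa using (continuous_const_add p).tendsto 0
    filter_upwards [ht.eventually hp] with q hq
    rw [← hq, add_smul, add_assoc]
  · have h1 : ContinuousAt (deriv Φ) 0 :=
      ((hΦ.continuousAt_fderiv (by simp)).clm_apply continuousAt_const :
        ContinuousAt (fun s => fderiv ℝ Φ s 1) 0)
    have h2 : ContinuousAt (fun p : ℝ => 2 * deriv Φ (p ^ 2)) 0 :=
      continuousAt_const.mul (h1.comp_of_eq (continuous_pow 2).continuousAt (by simp))
    simpa [hc.deriv] using hasDerivAt_id_mul h2

end Riem

/-! ### The conformal factor near the collinear points (0, t) -/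

namespace FourBody
open Filter Topology

/-- The point `(0, t)` of the affine chart, a collinear configuration. -/
def axisPt (t : ℝ) : Aff := !₂[0, (t : ℂ)]

/-- The first of the two imaginary directions at a collinear configuration. -/
def imag₀ : Aff := !₂[Complex.I, 0]

/-- The second of the two imaginary directions at a collinear configuration. -/
def imag₁ : Aff := !₂[0, Complex.I]

theorem axisPt_ne {t : ℝ} (h : lift (axisPt t) ∈ collisionFree) : t ≠ 0 ∧ 1 + t ≠ 0 ∧ 1 - t ≠ 0 := by
  refine ⟨?_, ?_, ?_⟩
  · rintro rfl
    exact h 2 3 (by decide) (by simp [jacobi_apply, lift, axisPt])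
  · intro h'
    obtain rfl : t = -1 := by linarith
    exact h 0 3 (by decide) (by simp [jacobi_apply, lift, axisPt]; ring)
  · intro h'
    obtain rfl : t = 1 := by linarith
    exact h 0 2 (by decide) (by simp [jacobi_apply, lift, axisPt])

/-- On the slice z₁ = 1 the differences within the two pairs are √2 and √2 x₁. The four cross
differences are x₀ ± (1 ± x₁)/√2. -/
theorem factor_eq (m : ℝ) (x : Aff) : factor m x = m ^ 3 * (1 / 2 + 1 / (2 * Complex.normSq (x 1))
    + 1 / Complex.normSq (x 0 + ((√2)⁻¹ : ℝ) * (1 - x 1)) + 1 / Complex.normSq (x 0 + ((√2)⁻¹ : ℝ) * (1 + x 1))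
    + 1 / Complex.normSq (x 0 - ((√2)⁻¹ : ℝ) * (1 + x 1))
    + 1 / Complex.normSq (x 0 - ((√2)⁻¹ : ℝ) * (1 - x 1))) := by
  have h2 : ((√2 : ℝ) : ℂ) ^ 2 = 2 := by norm_cast; simp
  have h0 : ((√2 : ℝ) : ℂ) ≠ 0 := by norm_cast; simp
  have hn : Complex.normSq (√2 : ℝ) = 2 := by simp [Complex.normSq_ofReal]
  have e01 : Complex.normSq (jacobi (lift x) 0 - jacobi (lift x) 1) = 2 := by
    rw [← hn]; congr 1; simp [jacobi_apply, lift]; field_simp; linear_combination -h2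
  have e23 : Complex.normSq (jacobi (lift x) 2 - jacobi (lift x) 3) = 2 * Complex.normSq (x 1) := by
    rw [← hn, ← Complex.normSq_mul]; congr 1; simp [jacobi_apply, lift]; field_simp
    linear_combination -x 1 * h2
  have e02 : jacobi (lift x) 0 - jacobi (lift x) 2 = x 0 + (√2 : ℂ)⁻¹ * (1 - x 1) := by
    simp [jacobi_apply, lift]; ring
  have e03 : jacobi (lift x) 0 - jacobi (lift x) 3 = x 0 + (√2 : ℂ)⁻¹ * (1 + x 1) := by
    simp [jacobi_apply, lift]; ring
  have e12 : jacobi (lift x) 1 - jacobi (lift x) 2 = x 0 - (√2 : ℂ)⁻¹ * (1 + x 1) := by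
    simp [jacobi_apply, lift]; ring
  have e13 : jacobi (lift x) 1 - jacobi (lift x) 3 = x 0 - (√2 : ℂ)⁻¹ * (1 - x 1) := by
    simp [jacobi_apply, lift]; ring
  have i0 : Finset.Ioi (0 : Fin 4) = {1, 2, 3} := by decide
  have i1 : Finset.Ioi (1 : Fin 4) = {2, 3} := by decide
  have i2 : Finset.Ioi (2 : Fin 4) = {3} := by decide
  have i3 : Finset.Ioi (3 : Fin 4) = ∅ := by decide
  simp only [factor, potential, Fin.sum_univ_four, i0, i1, i2, i3, ← Complex.normSq_eq_norm_sq]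
  simp only [Finset.sum_insert (by decide : (1 : Fin 4) ∉ ({2, 3} : Finset (Fin 4))),
    Finset.sum_insert (by decide : (2 : Fin 4) ∉ ({3} : Finset (Fin 4))),
    Finset.sum_singleton, Finset.sum_empty, e01, e23, e02, e03, e12, e13, Complex.ofReal_inv]
  ring

theorem inv_sqrt_two_mul : (√2)⁻¹ * (√2)⁻¹ = (1 / 2 : ℝ) := by
  rw [← mul_inv, Real.mul_self_sqrt (by norm_num)]; norm_num

/-- The conformal factor in real coordinates. -/
theorem factor_eq_real (m : ℝ) (x : Aff) {a b c d : ℝ} (h0 : x 0 = ⟨a, b⟩) (h1 : x 1 = ⟨c, d⟩) :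
    factor m x = m ^ 3 * (1 / 2 + 1 / (c ^ 2 + d ^ 2) / 2
      + 1 / ((a + (√2)⁻¹ * (1 - c)) ^ 2 + (b - (√2)⁻¹ * d) ^ 2)
      + 1 / ((a + (√2)⁻¹ * (1 + c)) ^ 2 + (b + (√2)⁻¹ * d) ^ 2)
      + 1 / ((a - (√2)⁻¹ * (1 + c)) ^ 2 + (b - (√2)⁻¹ * d) ^ 2)
      + 1 / ((a - (√2)⁻¹ * (1 - c)) ^ 2 + (b + (√2)⁻¹ * d) ^ 2)) := by
  rw [factor_eq, h0, h1, mul_comm 2, ← div_div]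
  simp only [Complex.normSq_apply, Complex.add_re, Complex.add_im, Complex.sub_re, Complex.sub_im,
    Complex.re_ofReal_mul, Complex.im_ofReal_mul, Complex.one_re, Complex.one_im, zero_sub, zero_add,
    mul_neg, sub_neg_eq_add, ← pow_two, ← sub_eq_add_neg]

theorem factor_imag₀ (m t p : ℝ) : factor m (axisPt t + p • imag₀) =
    m ^ 3 * (1 / 2 + 1 / t ^ 2 / 2 + 4 / ((1 + t) ^ 2 + 2 * p ^ 2) + 4 / ((1 - t) ^ 2 + 2 * p ^ 2)) := by
  rw [factor_eq_real m _ (a := 0) (b := p) (c := t) (d := 0) (by simp [axisPt, imag₀, Complex.ext_iff])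
    (by simp [axisPt, imag₀, Complex.ext_iff])]
  have h (y : ℝ) : ((√2)⁻¹ * y) ^ 2 + p ^ 2 = (y ^ 2 + 2 * p ^ 2) / 2 := by
    linear_combination y ^ 2 * inv_sqrt_two_mul
  simp only [zero_add, zero_sub, neg_sq, mul_zero, sub_zero, add_zero, h, zero_pow two_ne_zero,
    one_div_div]
  ring

theorem factor_imag₁ (m t p : ℝ) : factor m (axisPt t + p • imag₁) =
    m ^ 3 * (1 / 2 + 1 / (t ^ 2 + p ^ 2) / 2 + 4 / ((1 + t) ^ 2 + p ^ 2)
      + 4 / ((1 - t) ^ 2 + p ^ 2)) := by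
  rw [factor_eq_real m _ (a := 0) (b := 0) (c := t) (d := p) (by simp [axisPt, imag₁, Complex.ext_iff])
    (by simp [axisPt, imag₁, Complex.ext_iff])]
  have h (y : ℝ) : ((√2)⁻¹ * y) ^ 2 + ((√2)⁻¹ * p) ^ 2 = (y ^ 2 + p ^ 2) / 2 := by
    linear_combination (y ^ 2 + p ^ 2) * inv_sqrt_two_mul
  simp only [zero_add, zero_sub, neg_sq, h, one_div_div]
  ring

theorem hasDerivAt_one_div_sq_add_sq {a b a' b' : ℝ} (h : a ^ 2 + b ^ 2 ≠ 0) :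
    HasDerivAt (fun q : ℝ => 1 / ((a + q * a') ^ 2 + (b + q * b') ^ 2))
      (-(2 * a * a' + 2 * b * b') / (a ^ 2 + b ^ 2) ^ 2) 0 := by
  have hl (a a' : ℝ) : HasDerivAt (fun q : ℝ => (a + q * a') ^ 2) (2 * a * a') 0 := by
    simpa using (((hasDerivAt_id (0 : ℝ)).mul_const a').const_add a).fun_pow 2
  simpa using ((hl a a').add (hl b b')).fun_inv (by simpa using h)

/-- The derivative of the conformal factor at a point of the axis. -/
theorem hasDerivAt_factor (m : ℝ) {t : ℝ} (h : lift (axisPt t) ∈ collisionFree) (w : Aff) :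
    HasDerivAt (fun q : ℝ => factor m (axisPt t + q • w))
      (m ^ 3 * (-1 / t ^ 3 - 8 / (1 + t) ^ 3 + 8 / (1 - t) ^ 3) * (w 1).re) 0 := by
  obtain ⟨h0, h1, h2⟩ := axisPt_ne h
  have hr : (√2)⁻¹ ≠ 0 := by positivity
  have hrr : (√2)⁻¹ ^ 2 = (1 / 2 : ℝ) := by rw [pow_two]; exact inv_sqrt_two_mul
  have hf (q : ℝ) := factor_eq_real m (axisPt t + q • w) (a := q * (w 0).re) (b := q * (w 0).im)
    (c := t + q * (w 1).re) (d := q * (w 1).im) (by simp [axisPt, Complex.ext_iff])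
    (by simp [axisPt, Complex.ext_iff])
  -- From here on only r ≠ 0 and r² = 1/2 matter.
  generalize (√2)⁻¹ = r at hr hrr hf
  have ht := (hasDerivAt_one_div_sq_add_sq (a := t) (b := 0) (a' := (w 1).re) (b' := (w 1).im)
    (by simpa using h0)).div_const 2
  have k1 := hasDerivAt_one_div_sq_add_sq (a := r * (1 - t)) (b := 0) (a' := (w 0).re - r * (w 1).re)
    (b' := (w 0).im - r * (w 1).im) (by simp [hr, h2])
  have k2 := hasDerivAt_one_div_sq_add_sq (a := r * (1 + t)) (b := 0) (a' := (w 0).re + r * (w 1).re)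
    (b' := (w 0).im + r * (w 1).im) (by simp [hr, h1])
  have k3 := hasDerivAt_one_div_sq_add_sq (a := -(r * (1 + t))) (b := 0)
    (a' := (w 0).re - r * (w 1).re) (b' := (w 0).im - r * (w 1).im) (by simp [hr, h1])
  have k4 := hasDerivAt_one_div_sq_add_sq (a := -(r * (1 - t))) (b := 0)
    (a' := (w 0).re + r * (w 1).re) (b' := (w 0).im + r * (w 1).im) (by simp [hr, h2])
  have := (((((ht.const_add (1 / 2)).add k1).add k2).add k3).add k4).const_mul (m ^ 3)
  refine (this.congr_of_eventuallyEq (Eventually.of_forall fun q => ?_)).congr_deriv ?_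
  · rw [hf]
    simp only [Pi.add_apply]
    ring
  · have e1 : ((r * (1 - t)) ^ 2 + 0 ^ 2) ^ 2 = (1 - t) ^ 4 / 4 := by
      linear_combination (1 - t) ^ 4 * (r ^ 2 + 1 / 2) * hrr
    have e2 : ((r * (1 + t)) ^ 2 + 0 ^ 2) ^ 2 = (1 + t) ^ 4 / 4 := by
      linear_combination (1 + t) ^ 4 * (r ^ 2 + 1 / 2) * hrr
    rw [neg_sq, neg_sq, e1, e2]
    field_simp
    linear_combination m ^ 3 * (w 1).re * t ^ 7 * 16 * (1 - t) * (1 + t) * ((1 + t) ^ 3 - (1 - t) ^ 3) * hrr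

/-! ### First derivatives and Christoffel symbols on the axis -/

theorem hermForm_formula (x u v : Aff) : hermForm x u v = realInner u v - (1 + ‖x‖ ^ 2)⁻¹ *
    (realInner x u * realInner x v + realInner (Complex.I • x) u * realInner (Complex.I • x) v) := rfl

theorem realInner_eq (u v : Aff) : realInner u v =
    (u 0).re * (v 0).re + (u 0).im * (v 0).im + ((u 1).re * (v 1).re + (u 1).im * (v 1).im) := by
  simp [realInner_apply, PiLp.inner_apply]
  ring

theorem norm_sq_eq (x : Aff) :
    ‖x‖ ^ 2 = (x 0).re ^ 2 + (x 0).im ^ 2 + ((x 1).re ^ 2 + (x 1).im ^ 2) := by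
  simp [EuclideanSpace.norm_sq_eq, ← Complex.normSq_eq_norm_sq, Complex.normSq_apply]
  ring

theorem hermForm_axisPt (t : ℝ) (u v : Aff) : hermForm (axisPt t) u v =
    (u 0).re * (v 0).re + (u 0).im * (v 0).im
      + ((u 1).re * (v 1).re + (u 1).im * (v 1).im) / (1 + t ^ 2) := by
  have : 1 + t ^ 2 ≠ 0 := by positivity
  rw [hermForm_formula, norm_sq_eq]
  simp only [realInner_eq]
  simp [axisPt]
  field_simp
  ring

theorem hasDerivAt_hermForm (x u a b : Aff) :
    HasDerivAt (fun q : ℝ => hermForm (x + q • u) a b)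
      (-((1 + ‖x‖ ^ 2)⁻¹ * (realInner u a * realInner x b + realInner x a * realInner u b
          + (realInner (Complex.I • u) a * realInner (Complex.I • x) b
            + realInner (Complex.I • x) a * realInner (Complex.I • u) b))
        - 2 * realInner x u / (1 + ‖x‖ ^ 2) ^ 2 * (realInner x a * realInner x b
          + realInner (Complex.I • x) a * realInner (Complex.I • x) b))) 0 := by
  have hl : ∀ u x a : Aff, HasDerivAt (fun q : ℝ => realInner (x + q • u) a) (realInner u a) 0 := by
    intro u x a
    simp only [map_add, map_smul, add_apply, smul_apply, smul_eq_mul]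
    simpa using ((hasDerivAt_id (0 : ℝ)).mul_const (realInner u a)).const_add (realInner x a)
  have hn : HasDerivAt (fun q : ℝ => ‖x + q • u‖ ^ 2) (2 * realInner x u) 0 := by
    have h1 : HasDerivAt (fun q : ℝ => x + q • u) u 0 := by
      simpa using ((hasDerivAt_id (0 : ℝ)).smul_const u).const_add x
    have h2 := h1.norm_sq
    rw [zero_smul, add_zero] at h2
    exact h2
  have hi : HasDerivAt (fun q : ℝ => (1 + ‖x + q • u‖ ^ 2)⁻¹)
      (-(2 * realInner x u) / (1 + ‖x‖ ^ 2) ^ 2) 0 := by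
    have h2 : (1 + ‖x + (0 : ℝ) • u‖ ^ 2) ≠ 0 := by positivity
    simpa using (hn.const_add 1).fun_inv h2
  have hI : ∀ q : ℝ, Complex.I • (x + q • u) = Complex.I • x + q • Complex.I • u := fun q => by
    rw [smul_add, smul_comm]
  simp only [hermForm_formula, hI]
  refine ((hi.mul (((hl u x a).mul (hl u x b)).add
    ((hl (Complex.I • u) (Complex.I • x) a).mul (hl (Complex.I • u) (Complex.I • x) b)))).const_sub
      (realInner a b)).congr_deriv ?_
  simp
  ring

/-- The value of the conformal factor at `(0, t)`. -/
def factorVal (t : ℝ) : ℝ := 1 / 2 + 1 / t ^ 2 / 2 + 4 / (1 + t) ^ 2 + 4 / (1 - t) ^ 2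

/-- The derivative of the conformal factor at `(0, t)` along the axis. -/
def factorDeriv (t : ℝ) : ℝ := -1 / t ^ 3 - 8 / (1 + t) ^ 3 + 8 / (1 - t) ^ 3

theorem factor_axisPt (m t : ℝ) : factor m (axisPt t) = m ^ 3 * factorVal t := by
  have := factor_imag₀ m t 0
  simpa [factorVal] using this

/-- Leibniz rule. To first order the conformal factor changes only along the axis, hence the single
component Re u₁. -/
theorem fderiv_quotForm (m : ℝ) {t : ℝ} (h : lift (axisPt t) ∈ collisionFree) {u a b : Aff} {c : ℝ}
    (hc : HasDerivAt (fun q : ℝ => hermForm (axisPt t + q • u) a b) c 0) :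
    fderiv ℝ (quotForm m) (axisPt t) u a b =
      m ^ 3 * factorDeriv t * (u 1).re * hermForm (axisPt t) a b + m ^ 3 * factorVal t * c := by
  refine Riem.fderiv_eq_of_line ((contDiffAt_quotForm m h).differentiableAt (by simp)) ?_
  have := (hasDerivAt_factor m h u).mul hc
  rw [zero_smul, add_zero, factor_axisPt] at this
  exact this

theorem fderiv_quotForm_axisPt (m : ℝ) {t : ℝ} (h : lift (axisPt t) ∈ collisionFree) (u a b : Aff) :
    fderiv ℝ (quotForm m) (axisPt t) u a b =
      m ^ 3 * factorDeriv t * (u 1).re * hermForm (axisPt t) a b + m ^ 3 * factorVal t *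
        (-((1 + t ^ 2)⁻¹ * (realInner u a * (t * (b 1).re) + t * (a 1).re * realInner u b
          + (realInner (Complex.I • u) a * (t * (b 1).im)
            + t * (a 1).im * realInner (Complex.I • u) b))
        - 2 * (t * (u 1).re) / (1 + t ^ 2) ^ 2 * (t ^ 2 * ((a 1).re * (b 1).re
          + (a 1).im * (b 1).im)))) := by
  have hn : ‖axisPt t‖ ^ 2 = t ^ 2 := by rw [norm_sq_eq]; simp [axisPt]
  have hr : ∀ a, realInner (axisPt t) a = t * (a 1).re := fun a => by
    rw [realInner_eq]; simp [axisPt]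
  have hi : ∀ a, realInner (Complex.I • axisPt t) a = t * (a 1).im := fun a => by
    rw [realInner_eq]; simp [axisPt]
  rw [fderiv_quotForm m h (hasDerivAt_hermForm (axisPt t) u a b)]
  simp only [hn, hr, hi]
  ring

/-- Conjugation fixes the axis point and reverses both imaginary directions, so a symbol of two of
them sees only the real part of w. The symmetry x₀ ↦ -x₀ then leaves Re w₁ for the two pure symbols
and Re w₀ for the mixed one. -/
theorem koszul_imag₀_imag₀ (m : ℝ) {t : ℝ} (h : lift (axisPt t) ∈ collisionFree) (w : Aff) :
    Riem.koszul (quotForm m) (axisPt t) imag₀ imag₀ w =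
      m ^ 3 * (-(factorVal t * t / (1 + t ^ 2) + factorDeriv t / 2) * (w 1).re) := by
  have : 1 + t ^ 2 ≠ 0 := by positivity
  rw [Riem.koszul_apply]
  simp only [fderiv_quotForm_axisPt m h, hermForm_axisPt, realInner_eq]
  simp [imag₀]
  field_simp
  ring

theorem koszul_imag₁_imag₁ (m : ℝ) {t : ℝ} (h : lift (axisPt t) ∈ collisionFree) (w : Aff) :
    Riem.koszul (quotForm m) (axisPt t) imag₁ imag₁ w =
      m ^ 3 * ((-factorDeriv t / (2 * (1 + t ^ 2)) + factorVal t * t / (1 + t ^ 2) ^ 2) * (w 1).re) := by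
  have : 1 + t ^ 2 ≠ 0 := by positivity
  rw [Riem.koszul_apply]
  simp only [fderiv_quotForm_axisPt m h, hermForm_axisPt, realInner_eq]
  simp [imag₁]
  field_simp
  ring

theorem koszul_imag₀_imag₁ (m : ℝ) {t : ℝ} (h : lift (axisPt t) ∈ collisionFree) (w : Aff) :
    Riem.koszul (quotForm m) (axisPt t) imag₀ imag₁ w =
      m ^ 3 * (factorVal t * t / (1 + t ^ 2) * (w 0).re) := by
  have : 1 + t ^ 2 ≠ 0 := by positivity
  rw [Riem.koszul_apply]
  simp only [fderiv_quotForm_axisPt m h, hermForm_axisPt, realInner_eq]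
  simp [imag₀, imag₁]
  field_simp
  ring

theorem eventually_line_mem {x : Aff} (h : lift x ∈ collisionFree) (u : Aff) :
    ∀ᶠ p in 𝓝 (0 : ℝ), lift (x + p • u) ∈ collisionFree :=
  (Riem.tendsto_line x u).eventually (isOpen_lift_mem.mem_nhds h)

theorem quotForm_symm (m : ℝ) (x u v : Aff) : quotForm m x u v = quotForm m x v u := by
  rw [quotForm_apply, quotForm_apply, hermForm_symm]

theorem quotForm_pos {m : ℝ} (hm : 0 < m) {x : Aff} (hx : lift x ∈ collisionFree) {u : Aff}
    (hu : u ≠ 0) : 0 < quotForm m x u u :=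
  mul_pos (factor_pos hm hx) (hermForm_pos x hu)

theorem isInvertible_quotForm {m : ℝ} (hm : 0 < m) {x : Aff} (hx : lift x ∈ collisionFree) :
    (quotForm m x).IsInvertible :=
  Riem.isInvertible_of_pos fun _ hu => quotForm_pos hm hx hu

theorem eventually_isInvertible {m : ℝ} (hm : 0 < m) {x : Aff} (hx : lift x ∈ collisionFree) :
    ∀ᶠ z in 𝓝 x, (quotForm m z).IsInvertible := by
  filter_upwards [isOpen_lift_mem.mem_nhds hx] with z hz using isInvertible_quotForm hm hz

theorem factorVal_pos (t : ℝ) : 0 < factorVal t := by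
  rw [factorVal]; positivity

/-- On the axis the metric is diagonal in real coordinates, so raising the index divides by F in the
x₀ directions and by F/(1+t²) in the x₁ directions, up to m³, where F is `factorVal t`. -/
theorem christoffel_imag₁_imag₁ {m : ℝ} (hm : 0 < m) {t : ℝ} (h : lift (axisPt t) ∈ collisionFree) :
    Riem.christoffel (quotForm m) (axisPt t) imag₁ imag₁ =
      !₂[0, ((-factorDeriv t / (2 * factorVal t) + t / (1 + t ^ 2) : ℝ) : ℂ)] := by
  refine Riem.christoffel_eq (isInvertible_quotForm hm h) ?_
  ext w
  have := (factorVal_pos t).ne'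
  rw [koszul_imag₁_imag₁ m h, quotForm_apply, hermForm_axisPt, factor_axisPt]
  simp only [Matrix.cons_val_zero, Matrix.cons_val_one, Complex.ofReal_re, Complex.ofReal_im,
    Complex.zero_re, Complex.zero_im]
  field_simp
  ring

theorem christoffel_imag₀_imag₁ {m : ℝ} (hm : 0 < m) {t : ℝ} (h : lift (axisPt t) ∈ collisionFree) :
    Riem.christoffel (quotForm m) (axisPt t) imag₀ imag₁ = !₂[((t / (1 + t ^ 2) : ℝ) : ℂ), 0] := by
  refine Riem.christoffel_eq (isInvertible_quotForm hm h) ?_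
  ext w
  rw [koszul_imag₀_imag₁ m h, quotForm_apply, hermForm_axisPt, factor_axisPt]
  simp only [Matrix.cons_val_zero, Matrix.cons_val_one, Complex.ofReal_re, Complex.ofReal_im,
    Complex.zero_re, Complex.zero_im]
  ring

/-! ### Second derivatives and the curvature of the imaginary plane -/

theorem hermForm_imag (t p q : ℝ) (u v : Aff) : hermForm (axisPt t + p • imag₀ + q • imag₁) u v =
    realInner u v - (1 + (p ^ 2 + (t ^ 2 + q ^ 2)))⁻¹ *
      ((p * (u 0).im + (t * (u 1).re + q * (u 1).im)) * (p * (v 0).im + (t * (v 1).re + q * (v 1).im))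
        + (-p * (u 0).re + (-q * (u 1).re + t * (u 1).im))
          * (-p * (v 0).re + (-q * (v 1).re + t * (v 1).im))) := by
  rw [hermForm_formula, norm_sq_eq]
  simp only [realInner_eq]
  simp [axisPt, imag₀, imag₁]

/-- The off-diagonal entry is pq times a continuous function of the displacements p and q. Its mixed
derivative is that function's value at the origin, with no derivative of the conformal factor. -/
theorem fderiv_fderiv_imag₀₁ (m : ℝ) {t : ℝ} (h : lift (axisPt t) ∈ collisionFree) :
    fderiv ℝ (fderiv ℝ (quotForm m)) (axisPt t) imag₀ imag₁ imag₀ imag₁ =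
      -(m ^ 3 * factorVal t / (1 + t ^ 2)) := by
  have hG := contDiffAt_quotForm m h
  have hv : ∀ p q : ℝ, quotForm m (axisPt t + p • imag₀ + q • imag₁) imag₀ imag₁ =
      q * (-(factor m (axisPt t + p • imag₀ + q • imag₁) * p * (1 + (p ^ 2 + (t ^ 2 + q ^ 2)))⁻¹)) := by
    intro p q
    rw [quotForm_apply, hermForm_imag, realInner_eq]
    simp [imag₀, imag₁]
    ring
  have hc : ∀ {x : Aff}, lift x ∈ collisionFree → ∀ u : Aff,
      ContinuousAt (fun q : ℝ => factor m (x + q • u)) 0 := by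
    intro x hx u
    exact (contDiffAt_factor m hx).continuousAt.comp_of_eq (by fun_prop) (by simp)
  refine Riem.fderiv_fderiv_eq_of_line hG
    (ψ := fun p => p * (-(factor m (axisPt t + p • imag₀) * (1 + (p ^ 2 + t ^ 2))⁻¹))) ?_ ?_
  · filter_upwards [eventually_line_mem h imag₀] with p hp
    simp only [hv]
    refine (Riem.hasDerivAt_id_mul ?_).congr_deriv ?_
    · refine (((hc hp imag₁).mul continuousAt_const).mul ?_).neg
      exact ContinuousAt.inv₀ (by fun_prop) (by positivity)
    · simp
      ring
  · refine (Riem.hasDerivAt_id_mul ?_).congr_deriv ?_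
    · refine ((hc h imag₀).mul ?_).neg
      exact ContinuousAt.inv₀ (by fun_prop) (by positivity)
    · simp [factor_axisPt]
      ring

theorem hasDerivAt_const_div_add {a b : ℝ} (c : ℝ) (ha : a ≠ 0) :
    HasDerivAt (fun s : ℝ => c / (a + b * s)) (-(c * b) / a ^ 2) 0 := by
  have h1 : HasDerivAt (fun s : ℝ => a + b * s) b 0 := by
    simpa using ((hasDerivAt_id (0 : ℝ)).const_mul b).const_add a
  have h2 := (hasDerivAt_const 0 c).fun_div h1 (by simpa using ha)
  simpa using h2

theorem contDiffAt_const_div_add {a b : ℝ} (c : ℝ) (ha : a ≠ 0) :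
    ContDiffAt ℝ 1 (fun s : ℝ => c / (a + b * s)) 0 :=
  ContDiffAt.fun_div contDiffAt_const (by fun_prop) (by simpa using ha)

/-- Along `imag₀` the entry depends only on s = p²: it is the conformal factor times 1 - t²/(1 + t²
+ s). -/
theorem fderiv_fderiv_imag₀ (m : ℝ) {t : ℝ} (h : lift (axisPt t) ∈ collisionFree) :
    fderiv ℝ (fderiv ℝ (quotForm m)) (axisPt t) imag₀ imag₀ imag₁ imag₁ =
      m ^ 3 * ((-16 / (1 + t) ^ 4 - 16 / (1 - t) ^ 4) / (1 + t ^ 2)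
        + 2 * factorVal t * t ^ 2 / (1 + t ^ 2) ^ 2) := by
  obtain ⟨h0, h1, h2⟩ := axisPt_ne h
  have hs : 1 + t ^ 2 ≠ 0 := by positivity
  have hf : HasDerivAt (fun s : ℝ => 1 / 2 + 1 / t ^ 2 / 2 + 4 / ((1 + t) ^ 2 + 2 * s)
      + 4 / ((1 - t) ^ 2 + 2 * s)) _ 0 :=
    ((hasDerivAt_const_div_add 4 (pow_ne_zero 2 h1)).const_add _).add
      (hasDerivAt_const_div_add 4 (pow_ne_zero 2 h2))
  have hg : HasDerivAt (fun s : ℝ => 1 - t ^ 2 / ((1 + t ^ 2) + 1 * s)) _ 0 :=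
    (hasDerivAt_const_div_add (t ^ 2) hs).const_sub 1
  have hf' : ContDiffAt ℝ 1 (fun s : ℝ => 1 / 2 + 1 / t ^ 2 / 2 + 4 / ((1 + t) ^ 2 + 2 * s)
      + 4 / ((1 - t) ^ 2 + 2 * s)) 0 :=
    (contDiffAt_const.add (contDiffAt_const_div_add 4 (pow_ne_zero 2 h1))).add
      (contDiffAt_const_div_add 4 (pow_ne_zero 2 h2))
  have hg' : ContDiffAt ℝ 1 (fun s : ℝ => 1 - t ^ 2 / ((1 + t ^ 2) + 1 * s)) 0 :=
    contDiffAt_const.sub (contDiffAt_const_div_add (t ^ 2) hs)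
  rw [Riem.fderiv_fderiv_eq_of_even (contDiffAt_quotForm m h) (Eventually.of_forall fun p => ?_)
    (contDiffAt_const.mul (hf'.mul hg')) ((hf.mul hg).const_mul (m ^ 3))]
  · simp only [mul_zero, add_zero, factorVal]
    field_simp
    ring
  · have := hermForm_imag t p 0 imag₁ imag₁
    rw [zero_smul, add_zero, realInner_eq] at this
    rw [quotForm_apply, factor_imag₀, this]
    simp [imag₁]
    ring

/-- Along `imag₁` the Hermitian form is constantly 1 on `imag₀`, so only the conformal factor
contributes. -/
theorem fderiv_fderiv_imag₁ (m : ℝ) {t : ℝ} (h : lift (axisPt t) ∈ collisionFree) :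
    fderiv ℝ (fderiv ℝ (quotForm m)) (axisPt t) imag₁ imag₁ imag₀ imag₀ =
      m ^ 3 * (-1 / t ^ 4 - 8 / (1 + t) ^ 4 - 8 / (1 - t) ^ 4) := by
  obtain ⟨h0, h1, h2⟩ := axisPt_ne h
  have hf : HasDerivAt (fun s : ℝ => 1 / 2 + 1 / (t ^ 2 + 1 * s) / 2 + 4 / ((1 + t) ^ 2 + 1 * s)
      + 4 / ((1 - t) ^ 2 + 1 * s)) _ 0 :=
    ((((hasDerivAt_const_div_add 1 (pow_ne_zero 2 h0)).div_const 2).const_add _).add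
      (hasDerivAt_const_div_add 4 (pow_ne_zero 2 h1))).add
      (hasDerivAt_const_div_add 4 (pow_ne_zero 2 h2))
  have hf' : ContDiffAt ℝ 1 (fun s : ℝ => 1 / 2 + 1 / (t ^ 2 + 1 * s) / 2 + 4 / ((1 + t) ^ 2 + 1 * s)
      + 4 / ((1 - t) ^ 2 + 1 * s)) 0 :=
    ((contDiffAt_const.add ((contDiffAt_const_div_add 1 (pow_ne_zero 2 h0)).div_const 2)).add
      (contDiffAt_const_div_add 4 (pow_ne_zero 2 h1))).add
      (contDiffAt_const_div_add 4 (pow_ne_zero 2 h2))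
  rw [Riem.fderiv_fderiv_eq_of_even (contDiffAt_quotForm m h) (Eventually.of_forall fun p => ?_)
    (contDiffAt_const.mul hf') (hf.const_mul (m ^ 3))]
  · field_simp
    ring
  · have := hermForm_imag t 0 p imag₀ imag₀
    rw [zero_smul, add_zero, realInner_eq] at this
    rw [quotForm_apply, factor_imag₁, this]
    simp [imag₀]

theorem apply_curvature_imag {m : ℝ} (hm : 0 < m) {t : ℝ} (h : lift (axisPt t) ∈ collisionFree) :
    quotForm m (axisPt t) (Riem.curvature (quotForm m) (axisPt t) imag₀ imag₁ imag₁) imag₀ =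
      m ^ 3 * (-factorVal t / (1 + t ^ 2) ^ 2
        + (8 / (1 + t) ^ 4 + 8 / (1 - t) ^ 4) / (1 + t ^ 2)
        + (1 / t ^ 4 + 8 / (1 + t) ^ 4 + 8 / (1 - t) ^ 4) / 2
        - factorDeriv t ^ 2 / (4 * factorVal t)) := by
  rw [Riem.apply_curvature (contDiffAt_quotForm m h) (Eventually.of_forall fun z => quotForm_symm m z)
    (eventually_isInvertible hm h),
    fderiv_fderiv_imag₀₁ m h, fderiv_fderiv_imag₀ m h, fderiv_fderiv_imag₁ m h,
    christoffel_imag₁_imag₁ hm h, christoffel_imag₀_imag₁ hm h, koszul_imag₀_imag₀ m h,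
    koszul_imag₀_imag₁ m h]
  have := (factorVal_pos t).ne'
  have hs : 1 + t ^ 2 ≠ 0 := by positivity
  -- The remaining identity holds with F, C and the three reciprocal fourth powers as independent
  -- quantities, so their formulas in t are hidden.
  generalize factorVal t = F at *
  generalize factorDeriv t = C at *
  simp only [Matrix.cons_val_zero, Matrix.cons_val_one, Complex.ofReal_re]
  have e (y : ℝ) : -16 / y = -2 * (8 / y) ∧ 16 / y = 2 * (8 / y) ∧ -1 / y = -(1 / y) := by
    refine ⟨?_, ?_, ?_⟩ <;> ring
  rw [(e _).1, (e _).2.1, (e _).2.2]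
  generalize 8 / (1 + t) ^ 4 = A
  generalize 8 / (1 - t) ^ 4 = B
  generalize 1 / t ^ 4 = D
  field_simp
  ring

/-- Over a common denominator, positive for t ≠ 0, ±1, the numerator is a polynomial in t² with
positive coefficients. They read the same backwards, in accordance with the exchange t ↦ 1/t of the
two pairs. -/
theorem curvature_coefficient_pos {t : ℝ} (h0 : t ≠ 0) (h1 : 1 + t ≠ 0) (h2 : 1 - t ≠ 0) :
    0 < -factorVal t / (1 + t ^ 2) ^ 2
        + (8 / (1 + t) ^ 4 + 8 / (1 - t) ^ 4) / (1 + t ^ 2)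
        + (1 / t ^ 4 + 8 / (1 + t) ^ 4 + 8 / (1 - t) ^ 4) / 2
        - factorDeriv t ^ 2 / (4 * factorVal t) := by
  have hu : 1 - t ^ 2 = (1 + t) * (1 - t) := by ring
  have hu0 : 1 - t ^ 2 ≠ 0 := hu ▸ mul_ne_zero h1 h2
  have hs : 1 + t ^ 2 ≠ 0 := by positivity
  have hd : (1 - t ^ 2) ^ 2 + 16 * t ^ 2 ≠ 0 := by positivity
  have e1 : factorVal t =
      (1 + t ^ 2) * ((1 - t ^ 2) ^ 2 + 16 * t ^ 2) / (2 * t ^ 2 * (1 - t ^ 2) ^ 2) := by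
    rw [factorVal, hu]
    field_simp
    ring
  have e2 : factorDeriv t =
      (16 * t ^ 4 * (3 + t ^ 2) - (1 - t ^ 2) ^ 3) / (t ^ 3 * (1 - t ^ 2) ^ 3) := by
    rw [factorDeriv, hu]
    field_simp
    ring
  have e3 : 8 / (1 + t) ^ 4 + 8 / (1 - t) ^ 4 =
      16 * (1 + 6 * t ^ 2 + t ^ 4) / (1 - t ^ 2) ^ 4 := by
    rw [hu]
    field_simp
    ring
  rw [add_assoc (1 / t ^ 4), e1, e2, e3]
  have key : -((1 + t ^ 2) * ((1 - t ^ 2) ^ 2 + 16 * t ^ 2) / (2 * t ^ 2 * (1 - t ^ 2) ^ 2))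
        / (1 + t ^ 2) ^ 2
      + 16 * (1 + 6 * t ^ 2 + t ^ 4) / (1 - t ^ 2) ^ 4 / (1 + t ^ 2)
      + (1 / t ^ 4 + 16 * (1 + 6 * t ^ 2 + t ^ 4) / (1 - t ^ 2) ^ 4) / 2
      - ((16 * t ^ 4 * (3 + t ^ 2) - (1 - t ^ 2) ^ 3) / (t ^ 3 * (1 - t ^ 2) ^ 3)) ^ 2
        / (4 * ((1 + t ^ 2) * ((1 - t ^ 2) ^ 2 + 16 * t ^ 2) / (2 * t ^ 2 * (1 - t ^ 2) ^ 2)))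
      = (8 + 32 * t ^ 2 + 312 * t ^ 4 + 1344 * t ^ 6 + 312 * t ^ 8 + 32 * t ^ 10 + 8 * t ^ 12)
        / ((1 + t ^ 2) * ((1 - t ^ 2) ^ 2 + 16 * t ^ 2) * t ^ 2 * (1 - t ^ 2) ^ 4) := by
    field_simp
    ring
  rw [key]
  positivity

/-! ### Positivity on the plane i T ℝP² -/

/-- The real plane `iℝ²` in `ℂ²`. -/
def imagPlane : Submodule ℝ Aff := Submodule.span ℝ (Set.range ![imag₀, imag₁])

theorem linearIndependent_imag : LinearIndependent ℝ ![imag₀, imag₁] := by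
  refine LinearIndependent.pair_iff.2 fun a b h => ?_
  have h0 : (a • imag₀ + b • imag₁) 0 = 0 := by rw [h]; rfl
  have h1 : (a • imag₀ + b • imag₁) 1 = 0 := by rw [h]; rfl
  simpa [imag₀, imag₁] using And.intro h0 h1

theorem mem_imagPlane {u : Aff} : u ∈ imagPlane ↔ ∃ a b : ℝ, a • imag₀ + b • imag₁ = u := by
  rw [imagPlane, Matrix.range_cons, Matrix.range_cons, Matrix.range_empty, Set.union_empty]
  exact Submodule.mem_span_pair

theorem finrank_imagPlane : Module.finrank ℝ imagPlane = 2 := by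
  rw [imagPlane, finrank_span_eq_card linearIndependent_imag, Fintype.card_fin]

theorem det_ne_zero_of_linearIndependent {E : Type*} [AddCommGroup E] [Module ℝ E] {u v : E}
    {a b c d : ℝ} (h : LinearIndependent ℝ ![a • u + b • v, c • u + d • v]) :
    a * d - b * c ≠ 0 := by
  intro h0
  have hp := LinearIndependent.pair_iff.1 h
  have h1 := hp d (-b) (by
    rw [show d • (a • u + b • v) + -b • (c • u + d • v) = (a * d - b * c) • u by module, h0, zero_smul])
  have h2 := hp (-c) a (by
    rw [show -c • (a • u + b • v) + a • (c • u + d • v) = (a * d - b * c) • v by module, h0, zero_smul])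
  obtain ⟨rfl, hb⟩ := h1
  obtain ⟨hc, rfl⟩ := h2
  obtain rfl : b = 0 := by linarith
  have := hp 1 0 (by simp)
  exact one_ne_zero this.1

theorem gram_axisPt (m t a b c d : ℝ) :
    quotForm m (axisPt t) (a • imag₀ + b • imag₁) (a • imag₀ + b • imag₁)
      * quotForm m (axisPt t) (c • imag₀ + d • imag₁) (c • imag₀ + d • imag₁)
      - quotForm m (axisPt t) (a • imag₀ + b • imag₁) (c • imag₀ + d • imag₁) ^ 2
      = factor m (axisPt t) ^ 2 * (a * d - b * c) ^ 2 / (1 + t ^ 2) := by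
  simp only [quotForm_apply, hermForm_axisPt]
  simp [imag₀, imag₁]
  ring

/-- The curvature numerator and the Gram determinant both carry the factor (ad - bc)², nonzero by
independence, so the basis `imag₀`, `imag₁` decides the sign. -/
theorem sectional_imagPlane_pos {m : ℝ} (hm : 0 < m) {y : Shape} {t : ℝ} (hy : affine y = axisPt t)
    {u v : Aff} (hu : u ∈ imagPlane) (hv : v ∈ imagPlane) (h : LinearIndependent ℝ ![u, v]) :
    0 < Riem.sectional (quotMetric m hm) y u v := by
  obtain ⟨a, b, rfl⟩ := mem_imagPlane.1 hu
  obtain ⟨c, d, rfl⟩ := mem_imagPlane.1 hv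
  have hmem : lift (axisPt t) ∈ collisionFree := hy ▸ lift_affine_mem y
  have hdet := det_ne_zero_of_linearIndependent h
  obtain ⟨h0, h1, h2⟩ := axisPt_ne hmem
  have hf := factor_pos hm hmem
  have hc := curvature_coefficient_pos h0 h1 h2
  rw [sectional_quotMetric, hy, gram_axisPt, Riem.apply_curvature_basis (contDiffAt_quotForm m hmem)
    (Filter.Eventually.of_forall fun z => quotForm_symm m z) (eventually_isInvertible hm hmem),
    apply_curvature_imag hm hmem]
  have hdet2 : 0 < (a * d - b * c) ^ 2 := by positivity
  have hm3 : 0 < m ^ 3 := by positivity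
  exact div_pos (mul_pos hdet2 (mul_pos hm3 hc))
    (div_pos (mul_pos (by positivity) hdet2) (by positivity))

theorem positiveOn_imagPlane {m : ℝ} (hm : 0 < m) {y : Shape} {t : ℝ} (hy : affine y = axisPt t) :
    PositiveOn (quotMetric m hm) y imagPlane :=
  ⟨finrank_imagPlane, fun _ hu _ hv h => sectional_imagPlane_pos hm hy hu hv h⟩

/-- At a real point dπ has real coefficients in the chart and maps ℝ³ onto ℝ². -/
theorem iTangentRP_eq {z : collisionFree} (hz : (z : Jac) ∈ realVectors) :
    iTangentRP z = imagPlane := by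
  have h1 := apply_one_ne_zero z
  have hz0 := Complex.conj_eq_iff_im.2 (hz 0)
  have hz1 := Complex.conj_eq_iff_im.2 (hz 1)
  have hz2 := Complex.conj_eq_iff_im.2 (hz 2)
  have key : ∀ u : Aff, u ∈ imagPlane ↔ ∃ w ∈ realVectors, Complex.I • affineDeriv z w = u := by
    intro u
    rw [mem_imagPlane]
    constructor
    · rintro ⟨a, b, rfl⟩
      -- With middle component 0, dπ just divides the other two by z₁, giving (a, b).
      refine ⟨!₂[a * (z : Jac) 1, 0, b * (z : Jac) 1], fun i => ?_, ?_⟩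
      · fin_cases i <;> simp [hz 1]
      · ext i
        fin_cases i <;> simp [affineDeriv, imag₀, imag₁] <;> field_simp
    · rintro ⟨w, hw, rfl⟩
      have hr : ∀ i, (affineDeriv z w i).im = 0 := by
        intro i
        rw [← Complex.conj_eq_iff_im]
        have hw' := fun i => Complex.conj_eq_iff_im.2 (hw i)
        fin_cases i <;> simp [affineDeriv, hz0, hz1, hz2, hw']
      refine ⟨(affineDeriv z w 0).re, (affineDeriv z w 1).re, ?_⟩
      ext i
      fin_cases i <;> simp [imag₀, imag₁, Complex.ext_iff, hr]
  ext u
  refine Iff.trans ?_ (key u).symm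
  constructor
  · rintro ⟨_, ⟨w, hw, rfl⟩, rfl⟩
    exact ⟨w, hw, congrArg (fun a : Aff => Complex.I • a) (dproj_apply z w).symm⟩
  · rintro ⟨w, hw, rfl⟩
    exact ⟨_, ⟨w, hw, rfl⟩, congrArg (fun a : Aff => Complex.I • a) (dproj_apply z w)⟩

theorem affine_collinear {φ : ℝ} (h : collinear φ (Real.pi / 2) ∈ collisionFree) :
    affine (proj ⟨_, h⟩) = axisPt (Real.tan φ) := by
  rw [affine_proj]
  ext i
  fin_cases i <;> simp [collinear, axisPt, Complex.tan_eq_sin_div_cos]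

theorem collinear_mem_realVectors (φ θ : ℝ) : collinear φ θ ∈ realVectors := by
  intro i
  fin_cases i <;> simp only [collinear] <;> exact Complex.ofReal_im _

theorem affine_sample : affine (proj ⟨_, sample_mem⟩) = axisPt (1 / 2) := by
  rw [affine_proj]
  ext i
  fin_cases i <;> simp [axisPt]

end FourBody

end

theorem mainTheorem1 (m : ℝ) (hm : 0 < m) :
    ∃ g : Riem.Metric FourBody.Aff FourBody.Shape,
      FourBody.IsRiemannianSubmersion m g ∧
      (∀ g', FourBody.IsRiemannianSubmersion m g' → g' = g) ∧
      (∃ (y : FourBody.Shape) (σ : Submodule ℝ (TangentSpace 𝓘(ℝ, FourBody.Aff) y)),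
        FourBody.PositiveOn g y σ) ∧
      (∀ (φ : ℝ) (h : FourBody.collinear φ (Real.pi / 2) ∈ FourBody.collisionFree),
        FourBody.PositiveOn g (FourBody.proj ⟨_, h⟩) (FourBody.iTangentRP ⟨_, h⟩)) ∧
      ¬ ∀ (y : FourBody.Shape) (u v : TangentSpace 𝓘(ℝ, FourBody.Aff) y),
        LinearIndependent ℝ ![u, v] → Riem.sectional g y u v ≤ 0 := by
  refine ⟨FourBody.quotMetric m hm, FourBody.isRiemannianSubmersion_quotMetric m hm,
    fun g' hg' => FourBody.eq_quotMetric hm hg',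
    -- The collision-free sample (0, 2, 1), where t = 1/2, witnesses both the existence of a
    -- positive plane and the failure of non-positivity.
    ⟨_, _, FourBody.positiveOn_imagPlane hm FourBody.affine_sample⟩, fun φ h => ?_, fun hneg => ?_⟩
  · rw [FourBody.iTangentRP_eq (z := ⟨_, h⟩) (FourBody.collinear_mem_realVectors _ _)]
    exact FourBody.positiveOn_imagPlane hm (FourBody.affine_collinear h)
  · exact (hneg _ FourBody.imag₀ FourBody.imag₁ FourBody.linearIndependent_imag).not_gt
      (FourBody.sectional_imagPlane_pos hm FourBody.affine_sample
        (Submodule.subset_span ⟨0, rfl⟩) (Submodule.subset_span ⟨1, rfl⟩)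
        FourBody.linearIndependent_imag)
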